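/- Let $m\in\mathbb N$. **Notation.** Let $\vec\Phi$ be a smooth immersion of a two-dimensional smooth manifold $\Sigma^2$ into $\mathbb{R}^m$, with induced metric $g=\vec\Phi^*g_{\mathbb{R}^m}$; in local coordinates $g_{ij}=\langle\partial_{x_i}\vec\Phi,\partial_{x_j}\vec\Phi\rangle$ and $(g^{ij})=(g_{ij})^{-1}$. Let $\pi_{\vec n}$ be the orthogonal projection of $\mathbb{R}^m$ onto the normal space $(\vec\Phi_*T\Sigma^2)^\perp$, $\vec{\mathbb I}(X,Y)=\pi_{\vec n}(d^2\vec\Phi(X,Y))$ the second fundamental form, $\vec H=\frac12\sum_{i,j}g^{ij}\,\vec{\mathbb I}(\partial_{x_i},\partial_{x_j})$ the mean curvature vector, and $\tilde A(\vec X)=\sum_{i,j=1}^2\langle\vec{\mathbb I}(e_i,e_j),\vec X\rangle\,\vec{\mathbb I}(e_i,e_j)$ for any $g$-orthonormal basis $(e_1,e_2)$ of the tangent space. Let $\star$ be the Hodge operator $\wedge^p\mathbb{R}^m\to\wedge^{m-p}\mathbb{R}^m$, characterized by $\beta\wedge\star\alpha=\langle\beta,\alpha\rangle\,\varepsilon_1\wedge\cdots\wedge\varepsilon_m$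 ($1$-vectors are identified with vectors). For a local orientation of $\Sigma^2$, let $*_g$ be the Hodge operator of $g$ on forms ($\alpha\wedge *_g\beta=\langle\alpha,\beta\rangle_g\,dvol_g$), $d^{*_g}=-*_g d\,*_g$ the codifferential on $1$-forms, and $\vec n=\star(\vec e_1\wedge\vec e_2)\in\wedge^{m-2}\mathbb{R}^m$ the Gauss map, where $(\vec e_1,\vec e_2)$ is a positive orthonormal basis of $\vec\Phi_*T\Sigma^2$; the expression $\star(*_g d\vec n\wedge\vec H)$ does not depend on the orientation. Finally $\Delta_\perp\vec X=-\pi_{\vec n}\big[d^{*_g}\big(\pi_{\vec n}(d\vec X)\big)\big]$ is the (negative) covariant Laplacian of normal fields $\vec X$. **(1)** For every smooth immersion $\vec\Phi$ of a two-dimensional smooth manifold $\Sigma^2$ into $\mathbb{R}^m$, the following identity holds on $\Sigma^2$: $$\Delta_\perp\vec H+\tilde A(\vec H)-2|\vec H|^2\vec H=\tfrac12\, d^{*_g}\Big[d\vec H-3\,\pi_{\vec n}(d\vec H)+\star(*_g d\vec n\wedge\vec H)\Big].$$ **(2)** Let $D^2$ be the open unit disc of $\mathbb{R}^2$ and let $\vec\Phi:D^2\to\mathbb{R}^m$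 be a smooth immersion which is conformal, that is $|\partial_{x_1}\vec\Phi|=|\partial_{x_2}\vec\Phi|$ and $\langle\partial_{x_1}\vec\Phi,\partial_{x_2}\vec\Phi\rangle=0$, and has finite Willmore energy $W(\vec\Phi)=\int_{D^2}|\vec H|^2\,dvol_g<+\infty$. Then $\vec\Phi$ is Willmore, that is $\frac{d}{dt}W(\vec\Phi+t\vec\xi)\big|_{t=0}=0$ for all $\vec\xi\in C^\infty_0(D^2,\mathbb{R}^m)$, if and only if $$\mathrm{div}\Big[\nabla\vec H-3\,\pi_{\vec n}(\nabla\vec H)+\star(\nabla^\perp\vec n\wedge\vec H)\Big]=0\quad\text{on }D^2,$$ where $\mathrm{div}\,X=\partial_{x_1}X_1+\partial_{x_2}X_2$, $\nabla u=(\partial_{x_1}u,\partial_{x_2}u)$ and $\nabla^\perp u=(-\partial_{x_2}u,\partial_{x_1}u)$ are the flat operators. -/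

import Mathlib

open scoped ContDiff Manifold

noncomputable section

namespace WillmoreConservation

/-- The coordinate plane `ℝ²`. -/
abbrev Plane : Type := EuclideanSpace ℝ (Fin 2)

/-- The ambient Euclidean space `ℝᵐ`. -/
abbrev Amb (m : ℕ) : Type := EuclideanSpace ℝ (Fin m)

/-- The coordinate vector field `∂_{x_i}`. -/
def coordVec (i : Fin 2) : Plane := EuclideanSpace.single i 1

/-- The partial derivative `∂_{x_i} u` of a map defined on (a part of) the plane. -/
def pd {W : Type*} [NormedAddCommGroup W] [NormedSpace ℝ W] (i : Fin 2) (u : Plane → W)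
    (x : Plane) : W :=
  fderiv ℝ u x (coordVec i)

/-! ### Multivectors of `ℝᵐ` -/

/-- The Grassmann algebra `⋀ ℝᵐ`; its product is the wedge product. -/
abbrev Multivec (m : ℕ) : Type := ExteriorAlgebra ℝ (Amb m)

/-- The basis of `⋀ ℝᵐ` made of the `ε_{i₁} ∧ ⋯ ∧ ε_{i_p}`, `i₁ < ⋯ < i_p`, indexed by the sets
`{i₁, …, i_p}`, where `ε` is the canonical basis of `ℝᵐ`. It is orthonormal for the canonical
scalar product on multivectors. -/
def multiBasis (m : ℕ) : Module.Basis (Finset (Fin m)) ℝ (Multivec m) :=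
  (EuclideanSpace.basisFun (Fin m) ℝ).toBasis.ExteriorAlgebra

/-- A vector of `ℝᵐ` as a `1`-vector. -/
def toMulti {m : ℕ} (v : Amb m) : Multivec m := ExteriorAlgebra.ι ℝ v

/-- The vector of `ℝᵐ` given by a `1`-vector. -/
def toVec {m : ℕ} (a : Multivec m) : Amb m := ExteriorAlgebra.ιInv a

/-- The Hodge operator `⋆ : ⋀ᵖ ℝᵐ → ⋀ᵐ⁻ᵖ ℝᵐ` (for all `p` at once), the linear map for which
`β ∧ ⋆α = ⟨β, α⟩ ε₁ ∧ ⋯ ∧ ε_m` for all `p`-vectors `α, β`. On the orthonormal basis, `⋆ ε_S` is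
`± ε_{Sᶜ}`, where the sign is the coefficient of `ε_S ∧ ε_{Sᶜ}` on `ε₁ ∧ ⋯ ∧ ε_m`. -/
def hodge (m : ℕ) : Multivec m →ₗ[ℝ] Multivec m :=
  (multiBasis m).constr ℝ fun S =>
    (multiBasis m).repr (multiBasis m S * multiBasis m Sᶜ) Finset.univ • multiBasis m Sᶜ

/-- The partial derivative of a multivector-valued map, taken on the coefficients in the canonical
basis. -/
def pdMulti {m : ℕ} (i : Fin 2) (u : Plane → Multivec m) (x : Plane) : Multivec m :=
  ∑ S : Finset (Fin m), pd i (fun y => (multiBasis m).repr (u y) S) x • multiBasis m S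

/-! ### Geometry of a surface patch

Here `f` is a smooth immersion of an open set of the plane into `ℝᵐ`: an immersion of a surface
read in local coordinates `(x₁, x₂)`. One-forms with values in a vector space `W` are given by their
two components `α i x = α_x(∂_{x_i})`. The orientation of the surface is the one for which the
coordinates are positive. -/

section Patch

variable {m : ℕ}

/-- The tangent plane `f_* T_x`, a subspace of `ℝᵐ`. -/
def tangentPlane (f : Plane → Amb m) (x : Plane) : Submodule ℝ (Amb m) :=
  LinearMap.range (fderiv ℝ f x).toLinearMap

/-- The orthogonal projection `π_n` onto the normal space to the tangent plane. -/
def normalProj (f : Plane → Amb m) (x : Plane) : Amb m →L[ℝ] Amb m :=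
  (tangentPlane f x)ᗮ.starProjection

/-- The matrix `g_{ij} = ⟨∂_{x_i} f, ∂_{x_j} f⟩` of the first fundamental form. -/
def metric (f : Plane → Amb m) (x : Plane) : Matrix (Fin 2) (Fin 2) ℝ :=
  Matrix.of fun i j => inner ℝ (pd i f x) (pd j f x)

/-- The inverse matrix `g^{ij}`. -/
def metricInv (f : Plane → Amb m) (x : Plane) : Matrix (Fin 2) (Fin 2) ℝ :=
  (metric f x)⁻¹

/-- The density `√(det g)` of the area form `dvol_g`. -/
def areaDensity (f : Plane → Amb m) (x : Plane) : ℝ :=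
  Real.sqrt (metric f x).det

/-- The second fundamental form `𝕀_x(X, Y) = π_n (d²f(X, Y))`. -/
def secondForm (f : Plane → Amb m) (x : Plane) (X Y : Plane) : Amb m :=
  normalProj f x (fderiv ℝ (fderiv ℝ f) x X Y)

/-- The mean curvature vector `H = ½ ∑ g^{ij} 𝕀(∂_{x_i}, ∂_{x_j})`. -/
def meanCurv (f : Plane → Amb m) (x : Plane) : Amb m :=
  (1 / 2 : ℝ) • ∑ i, ∑ j, metricInv f x i j • secondForm f x (coordVec i) (coordVec j)

/-- The map `Ã(X) = ∑ ⟨𝕀(e_i, e_j), X⟩ 𝕀(e_i, e_j)`, where `(e₁, e₂)` is meant to be an orthonormal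
basis of the tangent space at `x` for the induced metric. -/
def tildeA (f : Plane → Amb m) (x : Plane) (e : Fin 2 → Plane) (X : Amb m) : Amb m :=
  ∑ i, ∑ j, inner ℝ (secondForm f x (e i) (e j)) X • secondForm f x (e i) (e j)

/-- The Gauss map `n = ⋆(e₁ ∧ e₂)`, an `(m-2)`-vector, where
`e₁ ∧ e₂ = (∂_{x_1} f ∧ ∂_{x_2} f) / √(det g)` for each positive orthonormal basis `(e₁, e₂)` of the
tangent plane. -/
def gaussMap (f : Plane → Amb m) (x : Plane) : Multivec m :=
  hodge m ((areaDensity f x)⁻¹ • (toMulti (pd 0 f x) * toMulti (pd 1 f x)))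

/-- The Hodge operator `*_g` on one-forms, `α ∧ *_g β = ⟨α, β⟩_g dvol_g`. In coordinates
`(*_g α)_1 = -√(det g) ∑ g^{i2} α_i` and `(*_g α)_2 = √(det g) ∑ g^{i1} α_i`. -/
def starOne {W : Type*} [AddCommGroup W] [Module ℝ W] (f : Plane → Amb m)
    (α : Fin 2 → Plane → W) : Fin 2 → Plane → W :=
  ![fun x => -(areaDensity f x • ∑ i, metricInv f x i 1 • α i x),
    fun x => areaDensity f x • ∑ i, metricInv f x i 0 • α i x]

/-- The Hodge operator `*_g` on two-forms `a dx₁ ∧ dx₂`, given by their coefficient `a`. -/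
def starTwo (f : Plane → Amb m) (a : Plane → Amb m) (x : Plane) : Amb m :=
  (areaDensity f x)⁻¹ • a x

/-- The exterior differential of a one-form, as the coefficient of `dx₁ ∧ dx₂`. -/
def extD (α : Fin 2 → Plane → Amb m) (x : Plane) : Amb m :=
  pd 0 (α 1) x - pd 1 (α 0) x

/-- The codifferential `d^{*_g} = - *_g d *_g` on one-forms with values in `ℝᵐ`. -/
def codiff (f : Plane → Amb m) (α : Fin 2 → Plane → Amb m) (x : Plane) : Amb m :=
  -starTwo f (extD (starOne f α)) x

/-- The one-form `π_n(dX)`. -/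
def normalD (f : Plane → Amb m) (X : Plane → Amb m) (i : Fin 2) (x : Plane) : Amb m :=
  normalProj f x (pd i X x)

/-- The negative covariant Laplacian of the normal bundle,
`Δ_⊥ X = -π_n (d^{*_g} (π_n (dX)))`. -/
def normalLaplacian (f : Plane → Amb m) (X : Plane → Amb m) (x : Plane) : Amb m :=
  -normalProj f x (codiff f (normalD f X) x)

/-- The one-form `dH - 3 π_n(dH) + ⋆(*_g dn ∧ H)` with values in `ℝᵐ`. -/
def conservedForm (f : Plane → Amb m) (i : Fin 2) (x : Plane) : Amb m :=
  pd i (meanCurv f) x - (3 : ℝ) • normalD f (meanCurv f) i x +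
    toVec (hodge m
      (starOne f (fun j => pdMulti j (gaussMap f)) i x * toMulti (meanCurv f x)))

/-! ### The flat operators and Willmore discs -/

/-- The vector field `∇^⊥ n = (-∂_{x_2} n, ∂_{x_1} n)` for the Gauss map `n`. -/
def perpGradGauss (f : Plane → Amb m) : Fin 2 → Plane → Multivec m :=
  ![fun x => -pdMulti 1 (gaussMap f) x, fun x => pdMulti 0 (gaussMap f) x]

/-- The vector field `∇H - 3 π_n(∇H) + ⋆(∇^⊥ n ∧ H)`. -/
def conservedField (f : Plane → Amb m) (i : Fin 2) (x : Plane) : Amb m :=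
  pd i (meanCurv f) x - (3 : ℝ) • normalProj f x (pd i (meanCurv f) x) +
    toVec (hodge m (perpGradGauss f i x * toMulti (meanCurv f x)))

/-- The flat divergence `∂_{x_1} X_1 + ∂_{x_2} X_2`. -/
def flatDiv (X : Fin 2 → Plane → Amb m) (x : Plane) : Amb m :=
  pd 0 (X 0) x + pd 1 (X 1) x

/-- The open unit disc `D²`. -/
def disc : Set Plane := Metric.ball 0 1

/-- Smooth immersions of the disc. -/
structure IsDiscImmersion (f : Plane → Amb m) : Prop where
  smooth : ContDiffOn ℝ ∞ f disc
  injective : ∀ x ∈ disc, Function.Injective (fderiv ℝ f x)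

/-- Conformality on the disc: `|∂_{x_1} f| = |∂_{x_2} f|` and `⟨∂_{x_1} f, ∂_{x_2} f⟩ = 0`. -/
def IsConformalOnDisc (f : Plane → Amb m) : Prop :=
  ∀ x ∈ disc, ‖pd 0 f x‖ = ‖pd 1 f x‖ ∧ inner ℝ (pd 0 f x) (pd 1 f x) = 0

/-- Finiteness of the Willmore energy `∫_{D²} |H|² dvol_g`. -/
def HasFiniteEnergy (f : Plane → Amb m) : Prop :=
  MeasureTheory.IntegrableOn (fun x => ‖meanCurv f x‖ ^ 2 * areaDensity f x) disc

/-- The Willmore energy `W(f) = ∫_{D²} |H|² dvol_g`. -/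
def energy (f : Plane → Amb m) : ℝ :=
  ∫ x in disc, ‖meanCurv f x‖ ^ 2 * areaDensity f x

/-- A Willmore immersion of the disc: a smooth immersion of finite Willmore energy, critical for all
smooth variations with compact support in the disc. -/
structure IsWillmoreDisc (f : Plane → Amb m) : Prop where
  immersion : IsDiscImmersion f
  finite : HasFiniteEnergy f
  critical : ∀ ξ : Plane → Amb m, ContDiff ℝ ∞ ξ → HasCompactSupport ξ → tsupport ξ ⊆ disc →
    HasDerivAt (fun t : ℝ => energy (fun x => f x + t • ξ x)) 0 0

end Patch

end WillmoreConservation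

end

noncomputable section

namespace WillmoreConservation

/-! ### Double Hodge dual of a bivector -/

section Multivectors

variable {m : ℕ}

/-! Write h_ij = ⟨H, ∂_i∂_j f⟩ and P_i = π_n(∂_i H). The rule ⋆(⋆(u ∧ v) ∧ w) = ⟨u, w⟩v − ⟨v, w⟩u
(`hodge_hodge_wedge`) turns ⋆(*_g dn ∧ H) into 2|H|² ∂_i f − h_i^l ∂_l f. Weingarten gives ∂_i H =
P_i − h_i^l ∂_l f, so the bracket is −2P + 2T with T_i = |H|² ∂_i f − h_i^l ∂_l f tangential
(`IsPatch.conservedForm_eq`).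

Half its codifferential is thus d*T − d*P. The normal part of d*T is Ã(H) − 2|H|²H
(`IsPatch.normalProj_codiff_tangentialForm`) and that of −d*P is Δ_⊥H. The tangential parts of d*T
and d*P agree (`IsPatch.inner_codiff_tangentialForm`): this is Codazzi, in the form of the symmetry
of third derivatives, together with the derivative of the trace relation g^{ij}h_ij = 2|H|². This
proves the identity.

The second part does not go through the identity. At a conformal immersion the first variation of
the density |H|² √(det g) is computed directly on the 2-jet (`hasDerivAt_jetDensity`). With X the
bracket, it equals the divergence of ⟨H, ∂_i ξ⟩ + ½⟨ξ, X_i⟩ minus ½⟨ξ, div X⟩. Differentiating under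
the integral and integrating the divergence away yields −½∫⟨ξ, div X⟩
(`hasDerivAt_energy_conformal`), and the fundamental lemma of the calculus of variations concludes.
-/

lemma toVec_toMulti (v : Amb m) : toVec (toMulti v) = v :=
  ExteriorAlgebra.ι_leftInverse (R := ℝ) (M := Amb m) v

lemma toMulti_mul_swap (u v : Amb m) : toMulti u * toMulti v = -(toMulti v * toMulti u) :=
  eq_neg_of_add_eq_zero_left (ExteriorAlgebra.ι_add_mul_swap u v)

/-- Even elements of the exterior algebra are central. This commutation is what fixes the signs in
`hodge_hodge_single_left`. -/
lemma bivector_mul_comm (u v : Amb m) (a : Multivec m) :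
    toMulti u * toMulti v * a = a * (toMulti u * toMulti v) := by
  induction a using ExteriorAlgebra.induction with
  | algebraMap r => exact (Algebra.commutes r _).symm
  | ι w =>
    change toMulti u * toMulti v * toMulti w = toMulti w * (toMulti u * toMulti v)
    rw [mul_assoc, toMulti_mul_swap v w, mul_neg, ← mul_assoc, toMulti_mul_swap u w, neg_mul,
      neg_neg, mul_assoc]
  | mul a b ha hb => rw [← mul_assoc, ha, mul_assoc, hb, mul_assoc]
  | add a b ha hb => rw [mul_add, ha, hb, add_mul]

lemma multiBasis_singleton (i : Fin m) :
    multiBasis m {i} = toMulti (EuclideanSpace.single i 1) := by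
  have h := ExteriorAlgebra.basis_apply_ofCard (R := ℝ)
    (EuclideanSpace.basisFun (Fin m) ℝ).toBasis (Finset.card_singleton i)
  rw [multiBasis, h, ExteriorAlgebra.ιMulti_family, ExteriorAlgebra.ιMulti_apply]
  simp [toMulti, Set.powersetCard.ofFinEmbEquiv_symm_apply, Set.powersetCard.ofCard]

/-- The sign is the signature of a shuffle; only its square is ever needed, so its value is left
unspecified. -/
lemma multiBasis_mul_of_disjoint {S T : Finset (Fin m)} (h : Disjoint S T) :
    ∃ s : ℝ, s * s = 1 ∧ multiBasis m S * multiBasis m T = s • multiBasis m (S ∪ T) := by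
  have := ExteriorAlgebra.basis_mul_of_disjoint (R := ℝ)
    (EuclideanSpace.basisFun (Fin m) ℝ).toBasis
    (Set.powersetCard.ofCard (rfl : S.card = S.card))
    (Set.powersetCard.ofCard (rfl : T.card = T.card)) h
  set σ := Equiv.Perm.sign (Set.powersetCard.permOfDisjoint
    (s := Set.powersetCard.ofCard (rfl : S.card = S.card))
    (t := Set.powersetCard.ofCard (rfl : T.card = T.card)) h) with hσ
  refine ⟨((σ : ℤ) : ℝ), ?_, ?_⟩
  · rcases Int.units_eq_one_or σ with h | h <;> simp [h]
  · have hu : ((Set.powersetCard.disjUnion (s := Set.powersetCard.ofCard (rfl : S.card = S.card))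
      (t := Set.powersetCard.ofCard (rfl : T.card = T.card)) h : Set.powersetCard (Fin m) _) :
        Finset (Fin m)) = S ∪ T := by
      rw [← Finset.disjUnion_eq_union S T h]; rfl
    rw [hu] at this
    refine Eq.trans this ?_
    rcases Int.units_eq_one_or σ with h | h <;> simp [h, multiBasis]

lemma multiBasis_mul_of_not_disjoint {S T : Finset (Fin m)} (h : ¬Disjoint S T) :
    multiBasis m S * multiBasis m T = 0 :=
  ExteriorAlgebra.basis_mul_of_not_disjoint (R := ℝ)
    (EuclideanSpace.basisFun (Fin m) ℝ).toBasis
    (Set.powersetCard.ofCard (rfl : S.card = S.card))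
    (Set.powersetCard.ofCard (rfl : T.card = T.card)) h

lemma hodge_multiBasis (S : Finset (Fin m)) :
    hodge m (multiBasis m S) =
      (multiBasis m).repr (multiBasis m S * multiBasis m Sᶜ) Finset.univ • multiBasis m Sᶜ :=
  (multiBasis m).constr_basis ℝ _ _

lemma hodge_hodge_single_left {i j : Fin m} (hij : i ≠ j) :
    hodge m (hodge m (toMulti (EuclideanSpace.single i 1) * toMulti (EuclideanSpace.single j 1))
      * toMulti (EuclideanSpace.single i 1)) = toMulti (EuclideanSpace.single j 1) := by
  obtain ⟨s, hs, hS⟩ := multiBasis_mul_of_disjoint (Finset.disjoint_singleton.2 hij)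
  obtain ⟨c, hc, hC⟩ := multiBasis_mul_of_disjoint
    (disjoint_compl_right : Disjoint ({i} ∪ {j} : Finset (Fin m)) ({i} ∪ {j})ᶜ)
  obtain ⟨t, -, hT⟩ := multiBasis_mul_of_disjoint
    (S := ({i} ∪ {j} : Finset (Fin m))ᶜ) (T := {i}) (by simp)
  have hU : (({i} ∪ {j} : Finset (Fin m))ᶜ ∪ {i})ᶜ = {j} := by
    ext k; simp only [Finset.mem_compl, Finset.mem_union, Finset.mem_singleton]; grind
  have hcomm := bivector_mul_comm (EuclideanSpace.single i 1) (EuclideanSpace.single j 1)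
    (multiBasis m ({i} ∪ {j})ᶜ)
  rw [Finset.union_compl] at hC
  simp only [← multiBasis_singleton] at hcomm ⊢
  rw [hS, smul_mul_assoc, hC, ← hS, ← mul_assoc, hT, smul_mul_assoc] at hcomm
  rw [hS, map_smul, hodge_multiBasis, hC, smul_mul_assoc, smul_mul_assoc, hT, map_smul, map_smul,
    map_smul, Finsupp.smul_apply, map_smul, hodge_multiBasis, hU, smul_smul, smul_smul, smul_smul]
  -- With r the coefficient of the last Hodge star, the expression has total sign s·c·t·r. The top
  -- coefficient of ε_iε_jε_C = ε_Cε_iε_j gives s·c = t·r, so the total is (s·c)² = 1.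
  have hr := congrArg (fun a => (multiBasis m).repr a Finset.univ) hcomm
  simp only [map_smul, Finsupp.smul_apply, Module.Basis.repr_self, Finsupp.single_eq_same,
    smul_eq_mul, mul_one] at hr ⊢
  rw [mul_assoc, mul_assoc, ← hr]
  have : s * (c * (s * c)) = 1 := by linear_combination c * c * hs + hc
  rw [this, one_smul]

lemma hodge_hodge_single (i j k : Fin m) :
    toVec (hodge m (hodge m
      (toMulti (EuclideanSpace.single i 1) * toMulti (EuclideanSpace.single j 1))
      * toMulti (EuclideanSpace.single k 1))) =
    inner ℝ (EuclideanSpace.single i (1 : ℝ)) (EuclideanSpace.single k (1 : ℝ)) •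
        EuclideanSpace.single j (1 : ℝ)
      - inner ℝ (EuclideanSpace.single j (1 : ℝ)) (EuclideanSpace.single k (1 : ℝ)) •
        EuclideanSpace.single i (1 : ℝ) := by
  by_cases hij : i = j
  · subst hij
    simp [toMulti, toVec]
  by_cases hki : k = i
  · subst hki
    rw [hodge_hodge_single_left hij, toVec_toMulti]
    simp [EuclideanSpace.inner_single_left, hij]
  by_cases hkj : k = j
  · subst hkj
    rw [toMulti_mul_swap, map_neg, neg_mul, map_neg, hodge_hodge_single_left (Ne.symm hij)]
    rw [toVec, map_neg, ← toVec, toVec_toMulti]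
    simp [EuclideanSpace.inner_single_left, hij]
  -- Here k lies in the complement of {i, j}, so ⋆(ε_i ∧ ε_j) already contains ε_k and the product
  -- vanishes.
  · obtain ⟨s, -, hS⟩ := multiBasis_mul_of_disjoint (Finset.disjoint_singleton.2 hij)
    simp only [← multiBasis_singleton]
    rw [hS, map_smul, hodge_multiBasis, smul_mul_assoc, smul_mul_assoc,
      multiBasis_mul_of_not_disjoint (S := ({i} ∪ {j})ᶜ) (T := {k}) (by simp [hki, hkj])]
    simp [toVec, EuclideanSpace.inner_single_left, Ne.symm hki, Ne.symm hkj]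

lemma eq_of_eq_single {F G : Amb m → Amb m} (hF : IsLinearMap ℝ F) (hG : IsLinearMap ℝ G)
    (h : ∀ i, F (EuclideanSpace.single i 1) = G (EuclideanSpace.single i 1)) (v : Amb m) :
    F v = G v := by
  have : hF.mk' F = hG.mk' G :=
    (EuclideanSpace.basisFun (Fin m) ℝ).toBasis.ext fun i => by simpa using h i
  exact LinearMap.congr_fun this v

/-- `⋆(⋆(u ∧ v) ∧ w) = ⟨u, w⟩ v - ⟨v, w⟩ u`. -/
lemma hodge_hodge_wedge (u v w : Amb m) :
    toVec (hodge m (hodge m (toMulti u * toMulti v) * toMulti w)) =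
      (inner ℝ u w : ℝ) • v - (inner ℝ v w : ℝ) • u := by
  refine eq_of_eq_single (F := fun u => toVec (hodge m (hodge m (toMulti u * toMulti v)
    * toMulti w))) (G := fun u => (inner ℝ u w : ℝ) • v - (inner ℝ v w : ℝ) • u) ?_ ?_
    (fun i => ?_) u
  · constructor <;> intros <;> simp [toMulti, toVec, add_mul]
  · constructor <;> intros <;> simp [inner_add_left, inner_smul_left] <;> module
  refine eq_of_eq_single (F := fun v => toVec (hodge m (hodge m
    (toMulti (EuclideanSpace.single i 1) * toMulti v) * toMulti w)))
    (G := fun v => (inner ℝ (EuclideanSpace.single i (1 : ℝ)) w : ℝ) • v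
      - (inner ℝ v w : ℝ) • EuclideanSpace.single i (1 : ℝ)) ?_ ?_
    (fun j => ?_) v
  · constructor <;> intros <;> simp [toMulti, toVec, mul_add, add_mul]
  · constructor <;> intros <;> simp [inner_add_left, inner_smul_left] <;> module
  refine eq_of_eq_single (F := fun w => toVec (hodge m (hodge m
    (toMulti (EuclideanSpace.single i 1) * toMulti (EuclideanSpace.single j 1)) * toMulti w)))
    (G := fun w => (inner ℝ (EuclideanSpace.single i (1 : ℝ)) w : ℝ) •
        EuclideanSpace.single j (1 : ℝ)
      - (inner ℝ (EuclideanSpace.single j (1 : ℝ)) w : ℝ) • EuclideanSpace.single i (1 : ℝ)) ?_ ?_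
    (hodge_hodge_single i j) w
  · constructor <;> intros <;> simp [toMulti, toVec, mul_add]
  · constructor <;> intros <;> simp [inner_add_right, inner_smul_right] <;> module

end Multivectors

/-! ### Partial derivatives -/

section PartialDerivatives

variable {W : Type*} [NormedAddCommGroup W] [NormedSpace ℝ W] {x : Plane} {i : Fin 2}

lemma pd_add {u v : Plane → W} (hu : DifferentiableAt ℝ u x) (hv : DifferentiableAt ℝ v x) :
    pd i (fun y => u y + v y) x = pd i u x + pd i v x := by
  simp only [pd]; rw [fderiv_fun_add hu hv]; rfl

lemma pd_sub {u v : Plane → W} (hu : DifferentiableAt ℝ u x) (hv : DifferentiableAt ℝ v x) :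
    pd i (fun y => u y - v y) x = pd i u x - pd i v x := by
  simp only [pd]; rw [fderiv_fun_sub hu hv]; rfl

lemma pd_neg (u : Plane → W) : pd i (fun y => -u y) x = -pd i u x := by
  simp only [pd]; rw [fderiv_fun_neg]; rfl

lemma pd_const (c : W) : pd i (fun _ => c) x = 0 := by
  simp [pd]

lemma pd_smul {r : Plane → ℝ} {u : Plane → W} (hr : DifferentiableAt ℝ r x)
    (hu : DifferentiableAt ℝ u x) :
    pd i (fun y => r y • u y) x = pd i r x • u x + r x • pd i u x := by
  simp only [pd]; rw [fderiv_fun_smul hr hu]; simp [add_comm]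

lemma pd_const_smul (r : ℝ) {u : Plane → W} (hu : DifferentiableAt ℝ u x) :
    pd i (fun y => r • u y) x = r • pd i u x := by
  simp only [pd]; rw [fderiv_fun_const_smul hu]; rfl

lemma pd_mul {r s : Plane → ℝ} (hr : DifferentiableAt ℝ r x) (hs : DifferentiableAt ℝ s x) :
    pd i (fun y => r y * s y) x = pd i r x * s x + r x * pd i s x :=
  pd_smul hr hs

lemma pd_inner {m : ℕ} {u v : Plane → Amb m} (hu : DifferentiableAt ℝ u x)
    (hv : DifferentiableAt ℝ v x) :
    pd i (fun y => (inner ℝ (u y) (v y) : ℝ)) x =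
      inner ℝ (pd i u x) (v x) + inner ℝ (u x) (pd i v x) := by
  simp only [pd]; rw [fderiv_inner_apply ℝ hu hv, add_comm]

lemma pd_inv {r : Plane → ℝ} (hr : DifferentiableAt ℝ r x) (h : r x ≠ 0) :
    pd i (fun y => (r y)⁻¹) x = -pd i r x / r x ^ 2 := by
  simp only [pd]
  have := (hasDerivAt_inv h).comp_hasFDerivAt x hr.hasFDerivAt
  rw [show (fun y => (r y)⁻¹) = (fun z : ℝ => z⁻¹) ∘ r from rfl, this.fderiv]
  simp; ring

lemma pd_sqrt {r : Plane → ℝ} (hr : DifferentiableAt ℝ r x) (h : r x ≠ 0) :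
    pd i (fun y => Real.sqrt (r y)) x = pd i r x / (2 * Real.sqrt (r x)) := by
  simp only [pd]
  rw [(hr.hasFDerivAt.sqrt h).fderiv]
  simp; ring

lemma pd_congr {u v : Plane → W} {U : Set Plane} (hU : IsOpen U) (hx : x ∈ U)
    (h : ∀ y ∈ U, u y = v y) : pd i u x = pd i v x := by
  have : u =ᶠ[nhds x] v := Filter.eventuallyEq_of_mem (hU.mem_nhds hx) h
  rw [pd, pd, this.fderiv_eq]

lemma pd_contDiffOn {u : Plane → W} {U : Set Plane} (hU : IsOpen U) (hu : ContDiffOn ℝ ∞ u U)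
    (i : Fin 2) : ContDiffOn ℝ ∞ (pd i u) U :=
  (hu.fderiv_of_isOpen hU (by simp)).clm_apply contDiffOn_const

lemma pd_pd_eq {u : Plane → W} {U : Set Plane} (hU : IsOpen U) (hu : ContDiffOn ℝ ∞ u U)
    (hx : x ∈ U) (i j : Fin 2) :
    pd i (pd j u) x = fderiv ℝ (fderiv ℝ u) x (coordVec i) (coordVec j) := by
  have h : DifferentiableAt ℝ (fderiv ℝ u) x :=
    ((hu.fderiv_of_isOpen hU (m := ∞) (by simp)).contDiffAt (hU.mem_nhds hx)).differentiableAt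
      (by simp)
  change fderiv ℝ (fun y => fderiv ℝ u y (coordVec j)) x (coordVec i) = _
  rw [fderiv_clm_apply h (differentiableAt_const _)]
  simp

lemma pd_comm {u : Plane → W} {U : Set Plane} (hU : IsOpen U) (hu : ContDiffOn ℝ ∞ u U)
    (hx : x ∈ U) (i j : Fin 2) : pd i (pd j u) x = pd j (pd i u) x := by
  rw [pd_pd_eq hU hu hx, pd_pd_eq hU hu hx]
  exact ((hu.contDiffAt (hU.mem_nhds hx)).isSymmSndFDerivAt
    (by simp [minSmoothness_of_isRCLikeNormedField]; exact WithTop.coe_le_coe.2 le_top)).eq _ _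

lemma plane_eq_sum (X : Plane) : X = X 0 • coordVec 0 + X 1 • coordVec 1 := by
  ext k; fin_cases k <;> simp [coordVec]

lemma fderiv_apply_eq (u : Plane → W) (x X : Plane) :
    fderiv ℝ u x X = X 0 • pd 0 u x + X 1 • pd 1 u x := by
  conv_lhs => rw [plane_eq_sum X]
  simp [pd]

end PartialDerivatives

/-! ### Pointwise algebra of the first and second derivatives

For `a i = ∂_{x_i} f` and `b i j = ∂_{x_i} ∂_{x_j} f`. -/

section Jets

variable {E : Type*} [NormedAddCommGroup E] [InnerProductSpace ℝ E]

/-- The Gram matrix of two vectors. -/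
def gram (a : Fin 2 → E) : Matrix (Fin 2) (Fin 2) ℝ :=
  Matrix.of fun i j => inner ℝ (a i) (a j)

/-- The component of `v` normal to two independent vectors. -/
def normalPart (a : Fin 2 → E) (v : E) : E :=
  v - ∑ k, ∑ l, ((gram a)⁻¹ k l * inner ℝ (a k) v) • a l

/-- The mean curvature vector in terms of the first and second derivatives. -/
def jetMeanCurv (a : Fin 2 → E) (b : Fin 2 → Fin 2 → E) : E :=
  (1 / 2 : ℝ) • ∑ i, ∑ j, (gram a)⁻¹ i j • normalPart a (b i j)

lemma gram_apply (a : Fin 2 → E) (i j : Fin 2) : gram a i j = inner ℝ (a i) (a j) := rfl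

lemma gram_symm (a : Fin 2 → E) (i j : Fin 2) : gram a i j = gram a j i := real_inner_comm _ _

/-- True for singular matrices too, both inverses being zero by convention; hence it rewrites under
binders without a side condition. -/
lemma inv_fin_two_apply (M : Matrix (Fin 2) (Fin 2) ℝ) (i j : Fin 2) :
    M⁻¹ i j = M.det⁻¹ * !![M 1 1, -M 0 1; -M 1 0, M 0 0] i j := by
  rw [Matrix.inv_def, Matrix.adjugate_fin_two, Ring.inverse_eq_inv']
  simp

lemma gram_inv_symm (a : Fin 2 → E) (i j : Fin 2) : (gram a)⁻¹ i j = (gram a)⁻¹ j i := by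
  rw [inv_fin_two_apply, inv_fin_two_apply, gram_symm a 1 0]
  fin_cases i <;> fin_cases j <;> rfl

lemma gram_inv_mul (a : Fin 2 → E) (h : (gram a).det ≠ 0) (i j : Fin 2) :
    ∑ k, (gram a)⁻¹ i k * gram a k j = if i = j then 1 else 0 := by
  have := Matrix.nonsing_inv_mul (gram a) (isUnit_iff_ne_zero.2 h)
  rw [← Matrix.mul_apply, this, Matrix.one_apply]

lemma inner_normalPart (a : Fin 2 → E) (h : (gram a).det ≠ 0) (v : E) (l : Fin 2) :
    inner ℝ (a l) (normalPart a v) = 0 := by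
  have h0 := gram_inv_mul a h 0 l
  have h1 := gram_inv_mul a h 1 l
  simp only [Fin.sum_univ_two, gram_apply] at h0 h1
  simp only [normalPart, inner_sub_right, Fin.sum_univ_two, inner_add_right, inner_smul_right]
  rw [real_inner_comm (a 0) (a l), real_inner_comm (a 1) (a l)]
  fin_cases l
  · simp at h0 h1 ⊢
    linear_combination -(inner ℝ (a 0) v) * h0 - (inner ℝ (a 1) v) * h1
  · simp at h0 h1 ⊢
    linear_combination -(inner ℝ (a 0) v) * h0 - (inner ℝ (a 1) v) * h1

lemma det_gram (a : Fin 2 → E) :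
    (gram a).det = gram a 0 0 * gram a 1 1 - gram a 0 1 * gram a 0 1 := by
  rw [Matrix.det_fin_two, gram_symm a 1 0]

lemma det_gram_nonneg (a : Fin 2 → E) : 0 ≤ (gram a).det := by
  rw [det_gram]
  have := real_inner_mul_inner_self_le (a 0) (a 1)
  simp only [gram_apply]; linarith

lemma det_gram_pos (a : Fin 2 → E) (h : LinearIndependent ℝ a) : 0 < (gram a).det := by
  have h1 : 0 < gram a 1 1 := real_inner_self_pos.2 (h.ne_zero 1)
  -- This is g₁₁ times the component of a₀ orthogonal to a₁; its squared norm is g₁₁ · det g.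
  have hv : gram a 1 1 • a 0 - gram a 0 1 • a 1 ≠ 0 := by
    intro hv
    have := (LinearIndependent.pair_iff (x := a 0) (y := a 1)).1
      (by rwa [show ![a 0, a 1] = a from by ext i; fin_cases i <;> rfl]) (gram a 1 1) (-gram a 0 1)
      (by rw [neg_smul, ← sub_eq_add_neg, hv])
    exact h1.ne' this.1
  have h2 := real_inner_self_pos.2 hv
  have h3 : inner ℝ (gram a 1 1 • a 0 - gram a 0 1 • a 1) (gram a 1 1 • a 0 - gram a 0 1 • a 1)
      = gram a 1 1 * (gram a).det := by
    rw [det_gram]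
    simp only [inner_sub_left, inner_sub_right, inner_smul_left, inner_smul_right, gram_apply,
      real_inner_comm (a 0) (a 1)]
    simp; ring
  rw [h3] at h2
  exact pos_of_mul_pos_right h2 h1.le

/-! ### Smooth dependence of the jet quantities on parameters -/

section Smooth

variable {X : Type*} [NormedAddCommGroup X] [NormedSpace ℝ X] {n : WithTop ℕ∞} {p : X}
  {a : Fin 2 → X → E} {b : Fin 2 → Fin 2 → X → E}

lemma contDiffAt_gram (ha : ∀ i, ContDiffAt ℝ n (a i) p) (i j : Fin 2) :
    ContDiffAt ℝ n (fun y => gram (fun k => a k y) i j) p :=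
  (ha i).inner ℝ (ha j)

lemma contDiffAt_det_gram (ha : ∀ i, ContDiffAt ℝ n (a i) p) :
    ContDiffAt ℝ n (fun y => (gram (fun k => a k y)).det) p := by
  simp only [det_gram]
  exact ((contDiffAt_gram ha 0 0).mul (contDiffAt_gram ha 1 1)).sub
    ((contDiffAt_gram ha 0 1).mul (contDiffAt_gram ha 0 1))

lemma contDiffAt_gram_inv (ha : ∀ i, ContDiffAt ℝ n (a i) p)
    (h : (gram (fun k => a k p)).det ≠ 0) (i j : Fin 2) :
    ContDiffAt ℝ n (fun y => (gram (fun k => a k y))⁻¹ i j) p := by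
  simp only [inv_fin_two_apply]
  refine ((contDiffAt_det_gram ha).inv h).mul ?_
  fin_cases i <;> fin_cases j
  · exact contDiffAt_gram ha 1 1
  · exact (contDiffAt_gram ha 0 1).neg
  · exact (contDiffAt_gram ha 1 0).neg
  · exact contDiffAt_gram ha 0 0

lemma contDiffAt_normalPart (ha : ∀ i, ContDiffAt ℝ n (a i) p)
    (h : (gram (fun k => a k p)).det ≠ 0) {v : X → E} (hv : ContDiffAt ℝ n v p) :
    ContDiffAt ℝ n (fun y => normalPart (fun k => a k y) (v y)) p := by
  unfold normalPart
  refine hv.sub (ContDiffAt.sum fun k _ => ContDiffAt.sum fun l _ => ?_)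
  exact ((contDiffAt_gram_inv ha h k l).mul ((ha k).inner ℝ hv)).smul (ha l)

lemma contDiffAt_jetMeanCurv (ha : ∀ i, ContDiffAt ℝ n (a i) p)
    (hb : ∀ i j, ContDiffAt ℝ n (b i j) p) (h : (gram (fun k => a k p)).det ≠ 0) :
    ContDiffAt ℝ n (fun y => jetMeanCurv (fun k => a k y) (fun i j => b i j y)) p := by
  unfold jetMeanCurv
  refine contDiffAt_const.smul (ContDiffAt.sum fun i _ => ContDiffAt.sum fun j _ => ?_)
  exact (contDiffAt_gram_inv ha h i j).smul (contDiffAt_normalPart ha h (hb i j))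

end Smooth

end Jets

/-! ### Geometry of a regular patch -/

section Patch

variable {m : ℕ} {f : Plane → Amb m} {U : Set Plane} {x : Plane}

/-- `f` is a smooth immersion of the open set `U`. -/
structure IsPatch (f : Plane → Amb m) (U : Set Plane) : Prop where
  isOpen : IsOpen U
  smooth : ContDiffOn ℝ ∞ f U
  det_ne : ∀ x ∈ U, (metric f x).det ≠ 0

lemma metric_eq_gram (f : Plane → Amb m) (x : Plane) :
    metric f x = gram (fun i => pd i f x) := rfl

lemma metricInv_eq_gram (f : Plane → Amb m) (x : Plane) :
    metricInv f x = (gram (fun i => pd i f x))⁻¹ := rfl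

lemma det_metric_pos_of_injective (h : Function.Injective (fderiv ℝ f x)) :
    0 < (metric f x).det := by
  refine det_gram_pos _ ?_
  have hc : LinearIndependent ℝ coordVec := by
    have h : coordVec = ⇑(EuclideanSpace.basisFun (Fin 2) ℝ).toBasis := by
      ext i; simp [coordVec]
    rw [h]
    exact (EuclideanSpace.basisFun (Fin 2) ℝ).toBasis.linearIndependent
  exact hc.map' (fderiv ℝ f x).toLinearMap (LinearMap.ker_eq_bot.2 h)

/-- Bridge from the abstract projection to a rational expression in the first derivatives, from
which smoothness in the base point follows. -/
lemma normalProj_eq (h : (metric f x).det ≠ 0) (v : Amb m) :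
    normalProj f x v = normalPart (fun i => pd i f x) v := by
  have hmem : ∀ i, pd i f x ∈ tangentPlane f x := fun i => ⟨coordVec i, rfl⟩
  refine Submodule.eq_starProjection_of_mem_of_inner_eq_zero ?_ ?_
  · rintro _ ⟨X, rfl⟩
    change inner ℝ (fderiv ℝ f x X) _ = (0 : ℝ)
    rw [fderiv_apply_eq, inner_add_left, inner_smul_left, inner_smul_left,
      inner_normalPart (fun i => pd i f x) h v 0, inner_normalPart (fun i => pd i f x) h v 1]
    simp
  · intro w hw
    refine hw _ ?_
    rw [normalPart, sub_sub_cancel]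
    exact Submodule.sum_mem _ fun k _ => Submodule.sum_mem _ fun l _ =>
      Submodule.smul_mem _ _ (hmem l)

lemma normalProj_pd (i : Fin 2) : normalProj f x (pd i f x) = 0 := by
  refine Submodule.starProjection_orthogonal_apply_eq_zero ?_
  exact ⟨coordVec i, rfl⟩

lemma normalProj_symm (v w : Amb m) :
    (inner ℝ (normalProj f x v) w : ℝ) = inner ℝ v (normalProj f x w) :=
  Submodule.inner_starProjection_left_eq_right _ _ _

lemma normalProj_idem (v : Amb m) : normalProj f x (normalProj f x v) = normalProj f x v :=
  Submodule.starProjection_eq_self_iff.2 (Submodule.starProjection_apply_mem _ _)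

lemma inner_normalProj_pd (v : Amb m) (i : Fin 2) :
    (inner ℝ (normalProj f x v) (pd i f x) : ℝ) = 0 := by
  rw [normalProj_symm, normalProj_pd, inner_zero_right]

lemma normalProj_meanCurv : normalProj f x (meanCurv f x) = meanCurv f x := by
  simp only [meanCurv, map_smul, map_sum, secondForm, normalProj_idem]

lemma inner_meanCurv_pd (i : Fin 2) : (inner ℝ (meanCurv f x) (pd i f x) : ℝ) = 0 := by
  rw [← normalProj_meanCurv, inner_normalProj_pd]

lemma metricInv_symm (f : Plane → Amb m) (x : Plane) (i j : Fin 2) :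
    metricInv f x i j = metricInv f x j i :=
  gram_inv_symm _ i j

namespace IsPatch

variable (hf : IsPatch f U)
include hf

lemma contDiffAt_pd (hx : x ∈ U) (i : Fin 2) : ContDiffAt ℝ ∞ (pd i f) x :=
  (pd_contDiffOn hf.isOpen hf.smooth i).contDiffAt (hf.isOpen.mem_nhds hx)

lemma contDiffOn_metricInv (i j : Fin 2) : ContDiffOn ℝ ∞ (fun y => metricInv f y i j) U :=
  fun x hx => (contDiffAt_gram_inv (hf.contDiffAt_pd hx) (hf.det_ne x hx) i j).contDiffWithinAt

lemma contDiffOn_normalProj {v : Plane → Amb m} (hv : ContDiffOn ℝ ∞ v U) :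
    ContDiffOn ℝ ∞ (fun y => normalProj f y (v y)) U := by
  refine ContDiffOn.congr (fun x hx => (contDiffAt_normalPart (hf.contDiffAt_pd hx)
    (hf.det_ne x hx) (hv.contDiffAt (hf.isOpen.mem_nhds hx))).contDiffWithinAt)
    fun y hy => normalProj_eq (hf.det_ne y hy) (v y)

lemma contDiffOn_areaDensity : ContDiffOn ℝ ∞ (areaDensity f) U :=
  fun x hx => ((contDiffAt_det_gram (hf.contDiffAt_pd hx)).sqrt (hf.det_ne x hx)).contDiffWithinAt

lemma areaDensity_pos (hx : x ∈ U) : 0 < areaDensity f x :=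
  Real.sqrt_pos.2 (lt_of_le_of_ne (det_gram_nonneg _) (hf.det_ne x hx).symm)

lemma secondForm_eq (hx : x ∈ U) (i j : Fin 2) :
    secondForm f x (coordVec i) (coordVec j) = normalProj f x (pd i (pd j f) x) := by
  rw [secondForm, pd_pd_eq hf.isOpen hf.smooth hx]

lemma meanCurv_eq (hx : x ∈ U) :
    meanCurv f x = (1 / 2 : ℝ) • ∑ i, ∑ j, metricInv f x i j • normalProj f x (pd i (pd j f) x) := by
  simp only [meanCurv, hf.secondForm_eq hx]

lemma meanCurv_eq_jet (hx : x ∈ U) :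
    meanCurv f x = jetMeanCurv (fun i => pd i f x) (fun i j => pd i (pd j f) x) := by
  simp only [hf.meanCurv_eq hx, normalProj_eq (hf.det_ne x hx)]
  rfl

lemma contDiffOn_meanCurv : ContDiffOn ℝ ∞ (meanCurv f) U := by
  refine ContDiffOn.congr (fun x hx => (contDiffAt_jetMeanCurv (hf.contDiffAt_pd hx)
    (fun i j => (pd_contDiffOn hf.isOpen (pd_contDiffOn hf.isOpen hf.smooth j) i).contDiffAt
      (hf.isOpen.mem_nhds hx)) (hf.det_ne x hx)).contDiffWithinAt)
    fun y hy => hf.meanCurv_eq_jet hy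

lemma differentiableAt {W : Type*} [NormedAddCommGroup W] [NormedSpace ℝ W] {u : Plane → W}
    (hu : ContDiffOn ℝ ∞ u U) (hx : x ∈ U) : DifferentiableAt ℝ u x :=
  (hu.contDiffAt (hf.isOpen.mem_nhds hx)).differentiableAt (by simp)

/-- A vector splits as its normal part plus its tangential part. -/
lemma normalProj_expand (hx : x ∈ U) (v : Amb m) :
    normalProj f x v = v - ∑ k, ∑ l, (metricInv f x k l * inner ℝ (pd k f x) v) • pd l f x :=
  normalProj_eq (hf.det_ne x hx) v

lemma metricInv_mul_metric (hx : x ∈ U) (i j : Fin 2) :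
    ∑ k, metricInv f x i k * inner ℝ (pd k f x) (pd j f x) = if i = j then (1 : ℝ) else 0 :=
  gram_inv_mul _ (hf.det_ne x hx) i j

lemma eq_zero_of_normal_of_inner (hx : x ∈ U) {v : Amb m} (h : normalProj f x v = 0)
    (h' : ∀ l, (inner ℝ (pd l f x) v : ℝ) = 0) : v = 0 := by
  have := hf.normalProj_expand hx v
  simpa [h, h'] using this.symm

lemma two_smul_meanCurv (hx : x ∈ U) :
    (2 : ℝ) • meanCurv f x =
      ∑ i, ∑ j, metricInv f x i j • normalProj f x (pd i (pd j f) x) := by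
  rw [hf.meanCurv_eq hx, smul_smul]; norm_num

/-- The trace of the second fundamental form in the direction `H` is `2 |H|²`. -/
lemma sum_metricInv_inner (hx : x ∈ U) :
    ∑ i, ∑ j, metricInv f x i j * inner ℝ (meanCurv f x) (pd i (pd j f) x)
      = (2 * inner ℝ (meanCurv f x) (meanCurv f x) : ℝ) := by
  rw [← inner_smul_right (𝕜 := ℝ), hf.two_smul_meanCurv hx]
  simp only [inner_sum, inner_smul_right, ← normalProj_symm, normalProj_meanCurv]

/-- For a normal vector `v`, the second fundamental form has trace `⟨v, 2 H⟩`. -/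
lemma sum_metricInv_inner_normalProj (hx : x ∈ U) (v : Amb m) :
    ∑ i, ∑ j, metricInv f x i j * inner ℝ (normalProj f x v) (pd i (pd j f) x)
      = (2 * inner ℝ v (meanCurv f x) : ℝ) := by
  rw [← inner_smul_right (𝕜 := ℝ), hf.two_smul_meanCurv hx]
  simp only [inner_sum, inner_smul_right, ← normalProj_symm]

/-- Weingarten: the tangential part of `∂_{x_i} H`. -/
lemma inner_pd_meanCurv (hx : x ∈ U) (i k : Fin 2) :
    (inner ℝ (pd k f x) (pd i (meanCurv f) x) : ℝ) =
      -inner ℝ (meanCurv f x) (pd i (pd k f) x) := by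
  have h := pd_inner (i := i) (hf.differentiableAt hf.contDiffOn_meanCurv hx)
    (hf.differentiableAt (pd_contDiffOn hf.isOpen hf.smooth k) hx)
  rw [pd_congr (v := fun _ => (0 : ℝ)) hf.isOpen hx (fun y _ => inner_meanCurv_pd k), pd_const,
    real_inner_comm] at h
  linarith

lemma normalD_meanCurv (hx : x ∈ U) (i : Fin 2) :
    normalD f (meanCurv f) i x = pd i (meanCurv f) x +
      ∑ k, ∑ l, (metricInv f x k l * inner ℝ (meanCurv f x) (pd i (pd k f) x)) • pd l f x := by
  rw [normalD, hf.normalProj_expand hx]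
  simp only [hf.inner_pd_meanCurv hx, mul_neg, neg_smul, Finset.sum_neg_distrib, sub_neg_eq_add]

end IsPatch

/-! #### The Gauss map term -/

/-- Each coefficient of ⋆(u ∧ v) is a bilinear form on a finite-dimensional space, hence continuous,
and the Leibniz rule applies coefficient by coefficient. -/
lemma pdMulti_hodge_wedge {u v : Plane → Amb m} (hu : DifferentiableAt ℝ u x)
    (hv : DifferentiableAt ℝ v x) (i : Fin 2) :
    pdMulti i (fun y => hodge m (toMulti (u y) * toMulti (v y))) x =
      hodge m (toMulti (pd i u x) * toMulti (v x)) +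
        hodge m (toMulti (u x) * toMulti (pd i v x)) := by
  let ι : Amb m →ₗ[ℝ] Multivec m := ExteriorAlgebra.ι ℝ
  let B : Amb m →ₗ[ℝ] Amb m →ₗ[ℝ] Multivec m :=
    ((LinearMap.mul ℝ (Multivec m)).compl₁₂ ι ι).compr₂ (hodge m)
  have key : ∀ S, pd i (fun y => (multiBasis m).repr (B (u y) (v y)) S) x =
      (multiBasis m).repr (B (pd i u x) (v x) + B (u x) (pd i v x)) S := by
    intro S
    let C : Amb m →L[ℝ] Amb m →L[ℝ] ℝ :=
      (B.compr₂ ((multiBasis m).coord S)).toContinuousBilinearMap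
    have h := (C.hasFDerivAt_of_bilinear hu.hasFDerivAt hv.hasFDerivAt).fderiv
    change fderiv ℝ (fun y => C (u y) (v y)) x (coordVec i) = _
    rw [h, map_add, Finsupp.add_apply, add_comm ((multiBasis m).repr _ S)]
    rfl
  change ∑ S, pd i (fun y => (multiBasis m).repr (B (u y) (v y)) S) x • multiBasis m S = _
  simp only [key]
  exact (multiBasis m).sum_repr _

/-- The normalizing factor is absorbed into the first vector before differentiating. Pairing with
the normal vector H kills every undifferentiated ∂_k f, in particular the term carrying the
derivative of the density, so only second derivatives of f survive. -/
lemma IsPatch.hodge_pdMulti_gaussMap (hf : IsPatch f U) (hx : x ∈ U) (i : Fin 2) :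
    toVec (hodge m (pdMulti i (gaussMap f) x * toMulti (meanCurv f x))) =
      (areaDensity f x)⁻¹ • ((inner ℝ (meanCurv f x) (pd i (pd 0 f) x) : ℝ) • pd 1 f x
        - (inner ℝ (meanCurv f x) (pd i (pd 1 f) x) : ℝ) • pd 0 f x) := by
  have hρ : DifferentiableAt ℝ (fun y => (areaDensity f y)⁻¹) x :=
    (hf.differentiableAt hf.contDiffOn_areaDensity hx).inv (hf.areaDensity_pos hx).ne'
  have ha := fun k => hf.differentiableAt (pd_contDiffOn hf.isOpen hf.smooth k) hx
  have hg : gaussMap f =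
      fun y => hodge m (toMulti ((areaDensity f y)⁻¹ • pd 0 f y) * toMulti (pd 1 f y)) := by
    ext y; simp [gaussMap, toMulti]
  have hadd : ∀ a b : Multivec m, toVec (a + b) = toVec a + toVec b := fun a b => map_add _ a b
  rw [hg, pdMulti_hodge_wedge (hρ.fun_smul (ha 0)) (ha 1), add_mul, map_add, hadd, hodge_hodge_wedge,
    hodge_hodge_wedge, pd_smul hρ (ha 0)]
  simp only [real_inner_comm (meanCurv f x), inner_add_right, inner_smul_right, inner_meanCurv_pd]
  simp
  module

end Patch

/-! ### The conserved form as normal plus tangential part; the codifferential in coordinates -/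

section Divergence

variable {m : ℕ} {f : Plane → Amb m} {U : Set Plane} {x : Plane}

/-- The tangential one-form `|H|² df - h_i^l ∂_{x_l} f`, where `h_{ij} = ⟨H, ∂_{x_i} ∂_{x_j} f⟩`. -/
def tangentialForm (f : Plane → Amb m) (i : Fin 2) (x : Plane) : Amb m :=
  ‖meanCurv f x‖ ^ 2 • pd i f x
    - ∑ k, ∑ l, (metricInv f x k l * inner ℝ (meanCurv f x) (pd i (pd k f) x)) • pd l f x

lemma normalProj_tangentialForm (i : Fin 2) : normalProj f x (tangentialForm f i x) = 0 := by
  simp [tangentialForm, normalProj_pd]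

namespace IsPatch

variable (hf : IsPatch f U)
include hf

lemma trace_fin_two (hx : x ∈ U) :
    metricInv f x 0 0 * inner ℝ (meanCurv f x) (pd 0 (pd 0 f) x)
      + 2 * (metricInv f x 0 1 * inner ℝ (meanCurv f x) (pd 0 (pd 1 f) x))
      + metricInv f x 1 1 * inner ℝ (meanCurv f x) (pd 1 (pd 1 f) x)
      = (2 * ‖meanCurv f x‖ ^ 2 : ℝ) := by
  have h := hf.sum_metricInv_inner hx
  simp only [Fin.sum_univ_two, metricInv_symm f x 1 0, pd_comm hf.isOpen hf.smooth hx 1 0] at h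
  rw [← real_inner_self_eq_norm_sq, ← h]; ring

/-- The conserved form, once `⋆(*_g dn ∧ H)` is seen to be `2 |H|² ∂_{x_i} f - ∑ h_i^l ∂_{x_l} f`. -/
lemma conservedForm_eq (hx : x ∈ U) (i : Fin 2) :
    conservedForm f i x =
      (-2 : ℝ) • normalD f (meanCurv f) i x + (2 : ℝ) • tangentialForm f i x := by
  have hT := hf.trace_fin_two hx
  have hρ := (hf.areaDensity_pos hx).ne'
  have hP := hf.normalD_meanCurv hx i
  have hadd : ∀ a b : Multivec m, toVec (a + b) = toVec a + toVec b := fun a b => map_add _ a b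
  have hsmul : ∀ (r : ℝ) (a : Multivec m), toVec (r • a) = r • toVec a := fun r a => map_smul _ r a
  have hneg : ∀ (a : Multivec m), toVec (-a) = -toVec a := fun a => map_neg _ a
  have key : toVec (hodge m
      (starOne f (fun j => pdMulti j (gaussMap f)) i x * toMulti (meanCurv f x))) =
      (2 * ‖meanCurv f x‖ ^ 2) • pd i f x
        - ∑ k, ∑ l, (metricInv f x k l * inner ℝ (meanCurv f x) (pd i (pd k f) x)) • pd l f x := by
    fin_cases i
    · simp only [starOne, Fin.sum_univ_two, Fin.zero_eta, Matrix.cons_val_zero, neg_mul,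
        smul_mul_assoc, add_mul, map_neg, map_smul, map_add, hadd, hsmul, hneg,
        hf.hodge_pdMulti_gaussMap hx, metricInv_symm f x 1 0, pd_comm hf.isOpen hf.smooth hx 1 0]
      -- Writing 2|H|² as the trace g^{kl}h_kl makes both sides combinations of ∂₀f and ∂₁f with
      -- coefficients linear in the g^{kl}h_ij, which are compared directly.
      rw [← hT]
      match_scalars <;> field_simp
      ring
    · simp only [starOne, Fin.sum_univ_two, Fin.mk_one, Matrix.cons_val_one,
        Matrix.cons_val_fin_one, smul_mul_assoc, add_mul, map_smul, map_add, hadd, hsmul,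
        hf.hodge_pdMulti_gaussMap hx, metricInv_symm f x 1 0, pd_comm hf.isOpen hf.smooth hx 1 0]
      rw [← hT]
      match_scalars <;> field_simp <;> ring
  -- Weingarten contributes a second copy of −h_i^l ∂_l f, hence the common factor 2; the normal
  -- parts add up to 1 − 3 = −2.
  rw [conservedForm, key, eq_sub_of_add_eq hP.symm, tangentialForm]
  module

/-! #### Derivatives of the metric -/

lemma differentiableAt_pd (hx : x ∈ U) (k : Fin 2) : DifferentiableAt ℝ (pd k f) x :=
  hf.differentiableAt (pd_contDiffOn hf.isOpen hf.smooth k) hx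

lemma pd_metric (hx : x ∈ U) (l p r : Fin 2) :
    pd l (fun y => gram (fun k => pd k f y) p r) x =
      inner ℝ (pd l (pd p f) x) (pd r f x) + inner ℝ (pd l (pd r f) x) (pd p f x) := by
  simp only [gram_apply]
  rw [pd_inner (hf.differentiableAt_pd hx p) (hf.differentiableAt_pd hx r),
    real_inner_comm (pd l (pd r f) x)]

lemma pd_det_metric (hx : x ∈ U) (l : Fin 2) :
    pd l (fun y => (gram (fun k => pd k f y)).det) x =
      2 * (inner ℝ (pd l (pd 0 f) x) (pd 0 f x) * gram (fun k => pd k f x) 1 1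
        + gram (fun k => pd k f x) 0 0 * inner ℝ (pd l (pd 1 f) x) (pd 1 f x)
        - gram (fun k => pd k f x) 0 1 *
      (inner ℝ (pd l (pd 0 f) x) (pd 1 f x) + inner ℝ (pd l (pd 1 f) x) (pd 0 f x))) := by
  have hg : ∀ p r, DifferentiableAt ℝ (fun y => gram (fun k => pd k f y) p r) x :=
    fun p r => (contDiffAt_gram (hf.contDiffAt_pd hx) p r).differentiableAt (by simp)
  simp only [det_gram]
  rw [pd_sub ((hg 0 0).fun_mul (hg 1 1)) ((hg 0 1).fun_mul (hg 0 1)), pd_mul (hg 0 0) (hg 1 1),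
    pd_mul (hg 0 1) (hg 0 1), hf.pd_metric hx, hf.pd_metric hx, hf.pd_metric hx]
  ring

/-- The rule ∂(g⁻¹) = −g⁻¹(∂g)g⁻¹, checked entry by entry on the explicit 2 × 2 inverse. -/
lemma pd_metricInv (hx : x ∈ U) (l i j : Fin 2) :
    pd l (fun y => metricInv f y i j) x = -∑ p, ∑ r, metricInv f x i p * metricInv f x j r *
      (inner ℝ (pd l (pd p f) x) (pd r f x) + inner ℝ (pd l (pd r f) x) (pd p f x)) := by
  have hg : ∀ p r, DifferentiableAt ℝ (fun y => gram (fun k => pd k f y) p r) x :=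
    fun p r => (contDiffAt_gram (hf.contDiffAt_pd hx) p r).differentiableAt (by simp)
  have hD := hf.det_ne x hx
  rw [metric_eq_gram] at hD
  have hdD := (contDiffAt_det_gram (hf.contDiffAt_pd hx)).differentiableAt (by simp)
  have hdI : DifferentiableAt ℝ (fun y => (gram (fun k => pd k f y)).det⁻¹) x := hdD.inv hD
  have hpI := pd_inv (i := l) hdD hD
  rw [hf.pd_det_metric hx] at hpI
  have hdet := det_gram (fun k => pd k f x)
  simp only [metricInv_eq_gram, inv_fin_two_apply, Fin.sum_univ_two]
  fin_cases i <;> fin_cases j <;>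
    simp only [Fin.zero_eta, Fin.mk_one, Matrix.of_apply, Matrix.cons_val', Matrix.cons_val_zero,
      Matrix.cons_val_one, Matrix.cons_val_fin_one, gram_symm _ 1 0]
  · rw [pd_mul hdI (hg _ _), hpI, hf.pd_metric hx]
    field_simp
    rw [hdet]; ring
  · rw [pd_mul hdI (hg _ _).fun_neg, pd_neg, hpI, hf.pd_metric hx]
    field_simp
    rw [hdet]; ring
  · rw [pd_mul hdI (hg _ _).fun_neg, pd_neg, hpI, hf.pd_metric hx]
    field_simp
    rw [hdet]; ring
  · rw [pd_mul hdI (hg _ _), hpI, hf.pd_metric hx]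
    field_simp
    rw [hdet]; ring

/-- Jacobi's formula ∂√(det g) = ½ √(det g) tr(g⁻¹∂g); the symmetry of g⁻¹ absorbs the ½. -/
lemma pd_areaDensity (hx : x ∈ U) (l : Fin 2) :
    pd l (areaDensity f) x = areaDensity f x *
      ∑ p, ∑ r, metricInv f x p r * inner ℝ (pd l (pd p f) x) (pd r f x) := by
  have hD := hf.det_ne x hx
  rw [metric_eq_gram] at hD
  have hρ := (hf.areaDensity_pos hx).ne'
  have hdD := (contDiffAt_det_gram (hf.contDiffAt_pd hx)).differentiableAt (by simp)
  have hsq : areaDensity f x ^ 2 = (gram (fun k => pd k f x)).det :=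
    Real.sq_sqrt (det_gram_nonneg _)
  have h := pd_sqrt (i := l) hdD hD
  rw [hf.pd_det_metric hx] at h
  change pd l (areaDensity f) x = _ / (2 * areaDensity f x) at h
  rw [h]
  simp only [metricInv_eq_gram, inv_fin_two_apply, Fin.sum_univ_two, Matrix.of_apply,
    Matrix.cons_val', Matrix.cons_val_zero, Matrix.cons_val_one, Matrix.cons_val_fin_one,
    gram_symm _ 1 0]
  rw [← hsq]
  field_simp
  ring

/-- The codifferential in terms of the inverse metric and the derivatives of `f`. -/
lemma codiff_eq (hx : x ∈ U) {α : Fin 2 → Plane → Amb m} (hα : ∀ i, DifferentiableAt ℝ (α i) x) :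
    codiff f α x =
      ∑ i, (∑ k, ∑ p, ∑ r, metricInv f x i k * metricInv f x p r *
        inner ℝ (pd p (pd r f) x) (pd k f x)) • α i x
      - ∑ i, ∑ j, metricInv f x i j • pd j (α i) x := by
  have hρ := (hf.areaDensity_pos hx).ne'
  have hdρ := hf.differentiableAt hf.contDiffOn_areaDensity hx
  have hq := fun i j => hf.differentiableAt (hf.contDiffOn_metricInv i j) hx
  have h0 : ∀ j, DifferentiableAt ℝ (fun y => ∑ i, metricInv f y i j • α i y) x := fun j =>
    DifferentiableAt.fun_sum fun i _ => (hq i j).smul (hα i)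
  have hpd : ∀ j, pd j (fun y => areaDensity f y • ∑ i, metricInv f y i j • α i y) x =
      pd j (areaDensity f) x • (∑ i, metricInv f x i j • α i x) + areaDensity f x •
        ∑ i, (pd j (fun y => metricInv f y i j) x • α i x + metricInv f x i j • pd j (α i) x) := by
    intro j
    rw [pd_smul hdρ (h0 j)]
    simp only [Fin.sum_univ_two]
    rw [pd_add ((hq 0 j).fun_smul (hα 0)) ((hq 1 j).fun_smul (hα 1)), pd_smul (hq 0 j) (hα 0),
      pd_smul (hq 1 j) (hα 1)]
  simp only [codiff, starTwo, extD, starOne, Matrix.cons_val_zero, Matrix.cons_val_one,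
    Matrix.cons_val_fin_one, pd_neg, sub_neg_eq_add]
  -- The derivative of the density cancels one of the two terms of ∂_j g^{ij}; what is left in front
  -- of α_i is the contracted Christoffel symbol g^{pr}Γ^i_{pr}.
  rw [hpd 0, hpd 1, hf.pd_areaDensity hx, hf.pd_areaDensity hx]
  simp only [hf.pd_metricInv hx, Fin.sum_univ_two, metricInv_symm f x 1 0,
    pd_comm hf.isOpen hf.smooth hx 1 0]
  match_scalars <;> field_simp <;> ring

end IsPatch

end Divergence

/-! ### Normal and tangential parts of the codifferential, and the identity -/

section Identity

variable {m : ℕ} {f : Plane → Amb m} {U : Set Plane} {x : Plane}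

namespace IsPatch

variable (hf : IsPatch f U)
include hf

lemma contDiffOn_pd (k : Fin 2) : ContDiffOn ℝ ∞ (pd k f) U :=
  pd_contDiffOn hf.isOpen hf.smooth k

lemma contDiffOn_pd_pd (i k : Fin 2) : ContDiffOn ℝ ∞ (pd i (pd k f)) U :=
  pd_contDiffOn hf.isOpen (hf.contDiffOn_pd k) i

lemma contDiffOn_normalD (i : Fin 2) : ContDiffOn ℝ ∞ (normalD f (meanCurv f) i) U :=
  hf.contDiffOn_normalProj (pd_contDiffOn hf.isOpen hf.contDiffOn_meanCurv i)

lemma contDiffOn_tangentialForm (i : Fin 2) : ContDiffOn ℝ ∞ (tangentialForm f i) U := by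
  refine (hf.contDiffOn_meanCurv.norm_sq ℝ |>.smul (hf.contDiffOn_pd i)).sub ?_
  refine ContDiffOn.sum fun k _ => ContDiffOn.sum fun l _ => ?_
  exact ((hf.contDiffOn_metricInv k l).mul
    (hf.contDiffOn_meanCurv.inner ℝ (hf.contDiffOn_pd_pd i k))).smul (hf.contDiffOn_pd l)

lemma contDiffOn_conservedForm (i : Fin 2) : ContDiffOn ℝ ∞ (conservedForm f i) U :=
  (((hf.contDiffOn_normalD i).const_smul (-2 : ℝ)).add
    ((hf.contDiffOn_tangentialForm i).const_smul (2 : ℝ))).congr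
    fun _ hy => hf.conservedForm_eq hy i

lemma codiff_conservedForm (hx : x ∈ U) :
    codiff f (conservedForm f) x = (-2 : ℝ) • codiff f (normalD f (meanCurv f)) x
      + (2 : ℝ) • codiff f (tangentialForm f) x := by
  have h1 := fun i => hf.differentiableAt (hf.contDiffOn_normalD i) hx
  have h2 := fun i => hf.differentiableAt (hf.contDiffOn_tangentialForm i) hx
  have hpd : ∀ i j, pd j (conservedForm f i) x = (-2 : ℝ) • pd j (normalD f (meanCurv f) i) x
      + (2 : ℝ) • pd j (tangentialForm f i) x := by
    intro i j
    rw [pd_congr hf.isOpen hx fun y hy => hf.conservedForm_eq hy i,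
      pd_add ((h1 i).fun_const_smul _) ((h2 i).fun_const_smul _), pd_const_smul _ (h1 i),
      pd_const_smul _ (h2 i)]
  rw [hf.codiff_eq hx fun i => hf.differentiableAt (hf.contDiffOn_conservedForm i) hx,
    hf.codiff_eq hx h1, hf.codiff_eq hx h2]
  simp only [hpd, hf.conservedForm_eq hx, Fin.sum_univ_two]
  module

/-- The derivative of the coefficient multiplies a tangent vector, so derivatives of g^{kl} and h_ik
never enter the normal part of dT. -/
lemma normalProj_pd_smul (hx : x ∈ U) {r : Plane → ℝ} (hr : DifferentiableAt ℝ r x)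
    (j l : Fin 2) :
    normalProj f x (pd j (fun y => r y • pd l f y) x) =
      r x • normalProj f x (pd j (pd l f) x) := by
  rw [pd_smul hr (hf.differentiableAt_pd hx l), map_add, map_smul, map_smul, normalProj_pd,
    smul_zero, zero_add]

lemma normalProj_pd_tangentialForm (hx : x ∈ U) (i j : Fin 2) :
    normalProj f x (pd j (tangentialForm f i) x) =
      ‖meanCurv f x‖ ^ 2 • normalProj f x (pd j (pd i f) x)
        - ∑ k, ∑ l, (metricInv f x k l * inner ℝ (meanCurv f x) (pd i (pd k f) x)) •
          normalProj f x (pd j (pd l f) x) := by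
  have hn : DifferentiableAt ℝ (fun y => ‖meanCurv f y‖ ^ 2) x :=
    hf.differentiableAt (hf.contDiffOn_meanCurv.norm_sq ℝ) hx
  have hr : ∀ k l, DifferentiableAt ℝ
      (fun y => metricInv f y k l * inner ℝ (meanCurv f y) (pd i (pd k f) y)) x := fun k l =>
    hf.differentiableAt ((hf.contDiffOn_metricInv k l).mul
      (hf.contDiffOn_meanCurv.inner ℝ (hf.contDiffOn_pd_pd i k))) hx
  have hs := fun k l => (hr k l).fun_smul (hf.differentiableAt_pd hx l)
  have he : tangentialForm f i = fun y => ‖meanCurv f y‖ ^ 2 • pd i f y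
    - (((metricInv f y 0 0 * inner ℝ (meanCurv f y) (pd i (pd 0 f) y)) • pd 0 f y
      + (metricInv f y 0 1 * inner ℝ (meanCurv f y) (pd i (pd 0 f) y)) • pd 1 f y)
      + ((metricInv f y 1 0 * inner ℝ (meanCurv f y) (pd i (pd 1 f) y)) • pd 0 f y
      + (metricInv f y 1 1 * inner ℝ (meanCurv f y) (pd i (pd 1 f) y)) • pd 1 f y)) := by
    ext1 y; simp only [tangentialForm, Fin.sum_univ_two]
  rw [he, pd_sub (hn.fun_smul (hf.differentiableAt_pd hx i))
    (((hs 0 0).fun_add (hs 0 1)).fun_add ((hs 1 0).fun_add (hs 1 1))),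
    pd_add ((hs 0 0).fun_add (hs 0 1)) ((hs 1 0).fun_add (hs 1 1)),
    pd_add (hs 0 0) (hs 0 1), pd_add (hs 1 0) (hs 1 1)]
  simp only [map_sub, map_add, hf.normalProj_pd_smul hx hn, hf.normalProj_pd_smul hx (hr _ _),
    Fin.sum_univ_two]

/-- The normal part of the codifferential of the tangential form. -/
lemma normalProj_codiff_tangentialForm (hx : x ∈ U) :
    normalProj f x (codiff f (tangentialForm f) x) =
      (∑ i, ∑ j, ∑ k, ∑ l, (metricInv f x i j * metricInv f x k l *
        inner ℝ (meanCurv f x) (pd i (pd k f) x)) • normalProj f x (pd j (pd l f) x))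
      - (2 * ‖meanCurv f x‖ ^ 2) • meanCurv f x := by
  -- The Christoffel term is tangential and dies under π_n; one factor 2H is reopened as a trace to
  -- match the |H|² term.
  rw [hf.codiff_eq hx fun i => hf.differentiableAt (hf.contDiffOn_tangentialForm i) hx,
    mul_comm, ← smul_smul, hf.two_smul_meanCurv hx]
  simp only [map_sub, map_add, map_smul, normalProj_tangentialForm,
    hf.normalProj_pd_tangentialForm hx, Fin.sum_univ_two, metricInv_symm f x 1 0,
    pd_comm hf.isOpen hf.smooth hx 1 0]
  module

/-- Lowering the index removes g⁻¹: T becomes the symmetric tensor |H|² g_il − h_il, which is easier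
to differentiate. -/
lemma inner_tangentialForm (hx : x ∈ U) (i l : Fin 2) :
    (inner ℝ (pd l f x) (tangentialForm f i x) : ℝ) =
      inner ℝ (meanCurv f x) (meanCurv f x) * inner ℝ (pd i f x) (pd l f x)
        - inner ℝ (meanCurv f x) (pd i (pd l f) x) := by
  have h0 := hf.metricInv_mul_metric hx 0 l
  have h1 := hf.metricInv_mul_metric hx 1 l
  simp only [tangentialForm, inner_sub_right, inner_add_right, inner_smul_right, Fin.sum_univ_two,
    ← real_inner_self_eq_norm_sq] at h0 h1 ⊢
  rw [real_inner_comm (pd i f x) (pd l f x), real_inner_comm (pd 0 f x) (pd l f x),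
    real_inner_comm (pd 1 f x) (pd l f x)]
  fin_cases l <;> simp at h0 h1 ⊢ <;>
  linear_combination (inner ℝ (meanCurv f x) (pd i (pd 0 f) x)) * h0
    + (inner ℝ (meanCurv f x) (pd i (pd 1 f) x)) * h1

/-- The tangential part of the derivative of the tangential form. -/
lemma inner_pd_tangentialForm (hx : x ∈ U) (i j l : Fin 2) :
    (inner ℝ (pd l f x) (pd j (tangentialForm f i) x) : ℝ) =
      2 * inner ℝ (pd j (meanCurv f) x) (meanCurv f x) * inner ℝ (pd i f x) (pd l f x)
        + inner ℝ (meanCurv f x) (meanCurv f x) * inner ℝ (pd j (pd i f) x) (pd l f x)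
        - (inner ℝ (pd j (meanCurv f) x) (pd i (pd l f) x)
          + inner ℝ (meanCurv f x) (pd j (pd i (pd l f)) x))
        + ∑ k, ∑ r, metricInv f x k r * inner ℝ (meanCurv f x) (pd i (pd k f) x) *
          inner ℝ (pd j (pd l f) x) (pd r f x) := by
  have hS := hf.differentiableAt (hf.contDiffOn_tangentialForm i) hx
  have hH := hf.differentiableAt hf.contDiffOn_meanCurv hx
  have ha := hf.differentiableAt_pd hx
  have hb := hf.differentiableAt (hf.contDiffOn_pd_pd i l) hx
  have h := pd_inner (i := j) (ha l) hS
  rw [pd_congr hf.isOpen hx fun y hy => hf.inner_tangentialForm hy i l,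
    pd_sub ((hH.inner ℝ hH).fun_mul ((ha i).inner ℝ (ha l))) (hH.inner ℝ hb),
    pd_mul (hH.inner ℝ hH) ((ha i).inner ℝ (ha l)), pd_inner hH hH, pd_inner (ha i) (ha l),
    pd_inner hH hb] at h
  simp only [tangentialForm, inner_sub_right, inner_add_right, inner_smul_right, Fin.sum_univ_two,
    ← real_inner_self_eq_norm_sq] at h ⊢
  rw [real_inner_comm (pd j (meanCurv f) x) (meanCurv f x),
    real_inner_comm (pd j (pd l f) x) (pd i f x)] at h
  linear_combination -h

/-- Derivative of the relation `∑ g^{ij} h_{ij} = 2 |H|²`. -/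
lemma pd_trace (hx : x ∈ U) (l : Fin 2) :
    ∑ i, ∑ j, (pd l (fun y => metricInv f y i j) x * inner ℝ (meanCurv f x) (pd i (pd j f) x)
      + metricInv f x i j * (inner ℝ (pd l (meanCurv f) x) (pd i (pd j f) x)
        + inner ℝ (meanCurv f x) (pd l (pd i (pd j f)) x)))
      = (4 * inner ℝ (pd l (meanCurv f) x) (meanCurv f x) : ℝ) := by
  have hH := hf.differentiableAt hf.contDiffOn_meanCurv hx
  have hb := fun i j => hf.differentiableAt (hf.contDiffOn_pd_pd i j) hx
  have hq := fun i j => hf.differentiableAt (hf.contDiffOn_metricInv i j) hx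
  have hs := fun i j => (hq i j).fun_mul (hH.inner ℝ (hb i j))
  have h : pd l (fun y => ∑ i, ∑ j, metricInv f y i j *
      inner ℝ (meanCurv f y) (pd i (pd j f) y)) x =
      pd l (fun y => (2 : ℝ) • (inner ℝ (meanCurv f y) (meanCurv f y) : ℝ)) x :=
    pd_congr hf.isOpen hx fun y hy => hf.sum_metricInv_inner hy
  rw [pd_const_smul _ (hH.inner ℝ hH), pd_inner hH hH,
    real_inner_comm (pd l (meanCurv f) x) (meanCurv f x)] at h
  simp only [Fin.sum_univ_two] at h ⊢
  rw [pd_add ((hs 0 0).fun_add (hs 0 1)) ((hs 1 0).fun_add (hs 1 1)),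
    pd_add (hs 0 0) (hs 0 1), pd_add (hs 1 0) (hs 1 1)] at h
  simp only [pd_mul (hq _ _) (hH.inner ℝ (hb _ _)), pd_inner hH (hb _ _), smul_eq_mul] at h
  linear_combination h

/-- Weingarten splitting of ∂_j H, isolating the pairing with π_n(∂_j H), which is all that d*(π_n
dH) sees tangentially. -/
lemma inner_pd_meanCurv_pd_pd (hx : x ∈ U) (j i l : Fin 2) :
    (inner ℝ (pd j (meanCurv f) x) (pd i (pd l f) x) : ℝ) =
      inner ℝ (normalD f (meanCurv f) j x) (pd i (pd l f) x)
      - ∑ k, ∑ r, metricInv f x k r * inner ℝ (meanCurv f x) (pd j (pd k f) x) *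
          inner ℝ (pd i (pd l f) x) (pd r f x) := by
  rw [hf.normalD_meanCurv hx]
  simp only [inner_add_left, inner_smul_left, Fin.sum_univ_two,
    real_inner_comm (pd _ f x) (pd i (pd l f) x)]
  simp

lemma inner_pd_normalD (hx : x ∈ U) (i j l : Fin 2) :
    (inner ℝ (pd l f x) (pd j (normalD f (meanCurv f) i) x) : ℝ) =
      -inner ℝ (normalD f (meanCurv f) i x) (pd j (pd l f) x) := by
  have h := pd_inner (i := j) (hf.differentiableAt (hf.contDiffOn_normalD i) hx)
    (hf.differentiableAt_pd hx l)
  rw [pd_congr (u := fun y => inner ℝ (normalD f (meanCurv f) i y) (pd l f y))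
    (v := fun _ => (0 : ℝ)) hf.isOpen hx (fun y _ => inner_normalProj_pd _ l),
    pd_const, real_inner_comm (pd l f x)] at h
  linarith

lemma pd_pd_pd_symm (hx : x ∈ U) (i : Fin 2) :
    pd i (pd 1 (pd 0 f)) x = pd i (pd 0 (pd 1 f)) x :=
  pd_congr hf.isOpen hx fun _ hy => pd_comm hf.isOpen hf.smooth hy 1 0

/-- Covariantly, the left side is ∇^i h_il − ∂_l|H|². By Codazzi, ∇^i h_il = ⟨π_n ∂_iH, 𝕀^i_l⟩ +
2⟨H, ∂_l H⟩, and the last term is ∂_l|H|². There remains ⟨π_n ∂_iH, 𝕀^i_l⟩, which is the right side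
because π_n dH is orthogonal to ∂_l f. -/
lemma inner_codiff_tangentialForm (hx : x ∈ U) (l : Fin 2) :
    (inner ℝ (pd l f x) (codiff f (tangentialForm f) x) : ℝ) =
      inner ℝ (pd l f x) (codiff f (normalD f (meanCurv f)) x) := by
  have h0 := hf.metricInv_mul_metric hx 0 l
  have h1 := hf.metricInv_mul_metric hx 1 l
  have hD := hf.pd_trace hx l
  have hC := hf.sum_metricInv_inner_normalProj hx (pd l (meanCurv f) x)
  change ∑ i, ∑ j, metricInv f x i j * inner ℝ (normalD f (meanCurv f) l x) (pd i (pd j f) x)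
    = _ at hC
  have hz : ∀ i, (inner ℝ (pd l f x) (normalD f (meanCurv f) i x) : ℝ) = 0 := fun i => by
    rw [real_inner_comm]; exact inner_normalProj_pd _ l
  rw [hf.codiff_eq hx fun i => hf.differentiableAt (hf.contDiffOn_tangentialForm i) hx,
    hf.codiff_eq hx fun i => hf.differentiableAt (hf.contDiffOn_normalD i) hx]
  simp only [hf.pd_metricInv hx] at hD
  simp only [inner_sub_right, inner_sum, inner_smul_right, hz, hf.inner_pd_normalD hx,
    hf.inner_pd_tangentialForm hx, hf.inner_tangentialForm hx]
  have h3 := fun k => pd_comm hf.isOpen (hf.contDiffOn_pd k) hx 1 0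
  fin_cases l
  all_goals
    simp only [Fin.zero_eta, Fin.mk_one, Fin.sum_univ_two, hf.inner_pd_meanCurv_pd_pd hx,
      metricInv_symm f x 1 0, pd_comm hf.isOpen hf.smooth hx 1 0, hf.pd_pd_pd_symm hx, h3,
      if_true, Fin.isValue, one_ne_zero, zero_ne_one, if_false,
      real_inner_comm (pd 0 f x) (pd 1 f x)] at h0 h1 hD hC ⊢
  all_goals
    -- `h0` and `h1` contract g^{ik}g_kl, both in the Christoffel term of |H|² g_il and in the
    -- derivative of |H|². `hD` trades the third derivatives of f, and `hC` evaluates the trace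
    -- paired with π_n(∂_l H).
    linear_combination
      (inner ℝ (meanCurv f x) (meanCurv f x) *
        (metricInv f x 0 0 * inner ℝ (pd 0 (pd 0 f) x) (pd 0 f x)
          + 2 * metricInv f x 0 1 * inner ℝ (pd 0 (pd 1 f) x) (pd 0 f x)
          + metricInv f x 1 1 * inner ℝ (pd 1 (pd 1 f) x) (pd 0 f x))
        - 2 * inner ℝ (pd 0 (meanCurv f) x) (meanCurv f x)) * h0
      + (inner ℝ (meanCurv f x) (meanCurv f x) *
        (metricInv f x 0 0 * inner ℝ (pd 0 (pd 0 f) x) (pd 1 f x)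
          + 2 * metricInv f x 0 1 * inner ℝ (pd 0 (pd 1 f) x) (pd 1 f x)
          + metricInv f x 1 1 * inner ℝ (pd 1 (pd 1 f) x) (pd 1 f x))
        - 2 * inner ℝ (pd 1 (meanCurv f) x) (meanCurv f x)) * h1 + hD - hC

lemma secondForm_expand (hx : x ∈ U) (X Y : Plane) :
    secondForm f x X Y = ∑ k, ∑ l, (X k * Y l) • normalProj f x (pd k (pd l f) x) := by
  simp only [← hf.secondForm_eq hx, secondForm]
  conv_lhs => rw [plane_eq_sum X, plane_eq_sum Y]
  simp only [map_add, map_smul, add_apply, smul_apply, Fin.sum_univ_two]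
  module

/-- `Ã(H)` in coordinates. -/
lemma tildeA_eq (hx : x ∈ U) {e : Fin 2 → Plane}
    (he : Orthonormal ℝ (fun i => fderiv ℝ f x (e i))) :
    tildeA f x e (meanCurv f x) =
      ∑ i, ∑ j, ∑ k, ∑ l, (metricInv f x i j * metricInv f x k l *
        inner ℝ (meanCurv f x) (pd i (pd k f) x)) • normalProj f x (pd j (pd l f) x) := by
  -- Orthonormality of the frame reads A g Aᵀ = 1, hence AᵀA = g⁻¹: frame sums become contractions
  -- with g^{kl}.
  let A : Matrix (Fin 2) (Fin 2) ℝ := Matrix.of fun i k => e i k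
  have hA : A * (metric f x * A.transpose) = 1 := by
    ext i j
    have hij := orthonormal_iff_ite.1 he i j
    rw [Matrix.one_apply, ← hij]
    simp only [fderiv_apply_eq f, Matrix.mul_apply, Fin.sum_univ_two, A, Matrix.of_apply,
      Matrix.transpose_apply, metric, inner_add_left, inner_add_right, inner_smul_left,
      inner_smul_right]
    simp
    ring
  have hq : A.transpose * A = metricInv f x := by
    rw [mul_eq_one_comm, Matrix.mul_assoc] at hA
    exact (Matrix.inv_eq_right_inv hA).symm
  have hqe : ∀ k l, metricInv f x k l = e 0 k * e 0 l + e 1 k * e 1 l := fun k l => by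
    rw [← hq]; simp [Matrix.mul_apply, A]
  have hin : ∀ k l, (inner ℝ (normalProj f x (pd k (pd l f) x)) (meanCurv f x) : ℝ) =
      inner ℝ (meanCurv f x) (pd k (pd l f) x) := fun k l => by
    rw [normalProj_symm, normalProj_meanCurv, real_inner_comm]
  simp only [tildeA, hf.secondForm_expand hx, sum_inner, inner_smul_left, hin, hqe]
  simp only [Fin.sum_univ_two, pd_comm hf.isOpen hf.smooth hx 1 0, conj_trivial]
  module

/-- The Willmore operator in divergence form. -/
theorem willmore_identity (hx : x ∈ U) {e : Fin 2 → Plane}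
    (he : Orthonormal ℝ (fun i => fderiv ℝ f x (e i))) :
    normalLaplacian f (meanCurv f) x + tildeA f x e (meanCurv f x)
        - (2 * ‖meanCurv f x‖ ^ 2) • meanCurv f x
      = (1 / 2 : ℝ) • codiff f (conservedForm f) x := by
  have hn := hf.normalProj_codiff_tangentialForm hx
  rw [← hf.tildeA_eq hx he] at hn
  -- The tangential parts cancel, so d*T − d*(π_n dH) equals its own normal projection.
  have key : codiff f (tangentialForm f) x - codiff f (normalD f (meanCurv f)) x
      - normalProj f x (codiff f (tangentialForm f) x - codiff f (normalD f (meanCurv f)) x)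
      = 0 := by
    refine hf.eq_zero_of_normal_of_inner hx ?_ fun l => ?_
    · rw [map_sub, normalProj_idem, sub_self]
    · rw [inner_sub_right, inner_sub_right, hf.inner_codiff_tangentialForm hx, sub_self,
        real_inner_comm, inner_normalProj_pd, sub_zero]
  rw [hf.codiff_conservedForm hx, normalLaplacian, add_sub_assoc, ← hn, neg_add_eq_sub, ← map_sub,
    ← sub_eq_zero.1 key]
  module

end IsPatch

end Identity

/-! ### Passage from the surface to its charts -/

section Charts

/-- An immersion of a surface read in a chart of the maximal atlas. -/
lemma isPatch_of_chart {m : ℕ} {M : Type*} [TopologicalSpace M] [ChartedSpace Plane M]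
    [IsManifold (𝓡 2) ∞ M] {Φ : M → Amb m} (hΦ : ContMDiff (𝓡 2) 𝓘(ℝ, Amb m) ∞ Φ)
    (hinj : ∀ p, Function.Injective (mfderiv (𝓡 2) 𝓘(ℝ, Amb m) Φ p))
    {φ : OpenPartialHomeomorph M Plane} (hφ : φ ∈ IsManifold.maximalAtlas (𝓡 2) ∞ M) :
    IsPatch (Φ ∘ φ.symm) φ.target := by
  have hsymm := contMDiffOn_symm_of_mem_maximalAtlas hφ
  have hφ' := contMDiffOn_of_mem_maximalAtlas hφ
  have hdiff : φ.MDifferentiable (𝓡 2) (𝓡 2) :=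
    ⟨hφ'.mdifferentiableOn (by simp), hsymm.mdifferentiableOn (by simp)⟩
  refine ⟨φ.open_target, ?_, fun x hx => (det_metric_pos_of_injective ?_).ne'⟩
  · exact contMDiffOn_iff_contDiffOn.1 (hΦ.comp_contMDiffOn hsymm)
  · have hc := mfderiv_comp x ((hΦ (φ.symm x)).mdifferentiableAt (by simp))
      (hdiff.mdifferentiableAt_symm hx)
    rw [mfderiv_eq_fderiv] at hc
    have h2 := hdiff.symm.mfderiv_injective (x := x) hx
    intro v w hvw
    rw [hc] at hvw
    exact h2 (hinj _ hvw)

end Charts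

/-! ### First variation of the energy density at a conformal 2-jet -/

section JetVariation

variable {E : Type*} [NormedAddCommGroup E] [InnerProductSpace ℝ E]

/-- The density `|H|² √(det g)` in terms of the first and second derivatives. -/
def jetDensity (a : Fin 2 → E) (b : Fin 2 → Fin 2 → E) : ℝ :=
  ‖jetMeanCurv a b‖ ^ 2 * Real.sqrt (gram a).det

lemma contDiffAt_jetDensity {X : Type*} [NormedAddCommGroup X] [NormedSpace ℝ X]
    {n : WithTop ℕ∞} {p : X} {a : Fin 2 → X → E} {b : Fin 2 → Fin 2 → X → E}
    (ha : ∀ i, ContDiffAt ℝ n (a i) p)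
    (hb : ∀ i j, ContDiffAt ℝ n (b i j) p) (h : (gram (fun k => a k p)).det ≠ 0) :
    ContDiffAt ℝ n (fun y => jetDensity (fun k => a k y) (fun i j => b i j y)) p :=
  ((contDiffAt_jetMeanCurv ha hb h).norm_sq ℝ).mul ((contDiffAt_det_gram ha).sqrt h)

variable (a α : Fin 2 → E) (b β : Fin 2 → Fin 2 → E)

lemma hasDerivAt_gram (i j : Fin 2) :
    HasDerivAt (fun t : ℝ => gram (fun k => a k + t • α k) i j)
      (inner ℝ (α i) (a j) + inner ℝ (α j) (a i)) 0 := by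
  have h : ∀ k, HasDerivAt (fun t : ℝ => a k + t • α k) (α k) 0 := fun k => by
    simpa using ((hasDerivAt_id (0 : ℝ)).smul_const (α k)).const_add (a k)
  have := (h i).inner ℝ (h j)
  simp only [zero_smul, add_zero] at this
  rw [add_comm, real_inner_comm (α j)] at this
  exact this

variable {a} {c : ℝ} (h00 : gram a 0 0 = c) (h11 : gram a 1 1 = c) (h01 : gram a 0 1 = 0)
  (hc : 0 < c)
include h00 h11 h01

lemma det_gram_conformal : (gram a).det = c ^ 2 := by
  rw [det_gram, h00, h11, h01]; ring

lemma gram_inv_conformal (i j : Fin 2) : (gram a)⁻¹ i j = if i = j then c⁻¹ else 0 := by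
  rw [inv_fin_two_apply, det_gram_conformal h00 h11 h01, gram_symm a 1 0, h00, h11, h01]
  rcases eq_or_ne c 0 with rfl | hc
  · fin_cases i <;> fin_cases j <;> simp
  · fin_cases i <;> fin_cases j <;> simp <;> field_simp

lemma hasDerivAt_det_gram_conformal :
    HasDerivAt (fun t : ℝ => (gram (fun k => a k + t • α k)).det)
      (2 * c * (inner ℝ (α 0) (a 0) + inner ℝ (α 1) (a 1))) 0 := by
  simp only [det_gram]
  have := ((hasDerivAt_gram a α 0 0).mul (hasDerivAt_gram a α 1 1)).sub
    ((hasDerivAt_gram a α 0 1).mul (hasDerivAt_gram a α 0 1))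
  simp only [zero_smul, add_zero, h00, h11, h01] at this
  refine this.congr_deriv ?_
  ring

include hc

lemma hasDerivAt_sqrt_det_gram_conformal :
    HasDerivAt (fun t : ℝ => Real.sqrt (gram (fun k => a k + t • α k)).det)
      (inner ℝ (α 0) (a 0) + inner ℝ (α 1) (a 1)) 0 := by
  have hd := det_gram_conformal h00 h11 h01
  have := (hasDerivAt_det_gram_conformal α h00 h11 h01).sqrt (by simp [hd, hc.ne'])
  simp only [zero_smul, add_zero, hd, Real.sqrt_sq hc.le] at this
  convert this using 1
  field_simp

lemma hasDerivAt_gram_inv_conformal (i j : Fin 2) :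
    HasDerivAt (fun t : ℝ => (gram (fun k => a k + t • α k))⁻¹ i j)
      (-(c⁻¹ ^ 2 * (inner ℝ (α i) (a j) + inner ℝ (α j) (a i)))) 0 := by
  have hd := det_gram_conformal h00 h11 h01
  have hI := (hasDerivAt_det_gram_conformal α h00 h11 h01).inv (by simp [hd, hc.ne'])
  simp only [inv_fin_two_apply]
  have h10 : gram a 1 0 = 0 := by rw [gram_symm, h01]
  fin_cases i <;> fin_cases j
  · have := hI.mul (hasDerivAt_gram a α 1 1)
    simp only [zero_smul, add_zero, hd, h11, Pi.inv_apply] at this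
    refine this.congr_deriv ?_
    simp; field_simp; ring
  · have := hI.mul (hasDerivAt_gram a α 0 1).neg
    simp only [zero_smul, add_zero, hd, h01, Pi.inv_apply, Pi.neg_apply] at this
    refine this.congr_deriv ?_
    simp; field_simp; ring
  · have := hI.mul (hasDerivAt_gram a α 1 0).neg
    simp only [zero_smul, add_zero, hd, h10, Pi.inv_apply, Pi.neg_apply] at this
    refine this.congr_deriv ?_
    simp; field_simp; ring
  · have := hI.mul (hasDerivAt_gram a α 0 0)
    simp only [zero_smul, add_zero, hd, h00, Pi.inv_apply] at this
    refine this.congr_deriv ?_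
    simp; field_simp; ring

/-- First variation of the mean curvature, paired with a fixed normal vector `N`. -/
lemma hasDerivAt_inner_jetMeanCurv {N : E} (hN : ∀ l, (inner ℝ N (a l) : ℝ) = 0)
    (htr : ∀ l, (inner ℝ (a l) (b 0 0) + inner ℝ (a l) (b 1 1) : ℝ) = 0) :
    HasDerivAt (fun t : ℝ => (inner ℝ N
        (jetMeanCurv (fun k => a k + t • α k) (fun i j => b i j + t • β i j)) : ℝ))
      ((1 / 2) * (c⁻¹ * (inner ℝ N (β 0 0) + inner ℝ N (β 1 1))
        - ∑ i, ∑ j, c⁻¹ ^ 2 * (inner ℝ (α i) (a j) + inner ℝ (α j) (a i)) * inner ℝ N (b i j))) 0 := by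
  have hq := hasDerivAt_gram_inv_conformal α h00 h11 h01 hc
  have hb : ∀ i j, HasDerivAt (fun t : ℝ => (inner ℝ N (b i j) : ℝ) + t * inner ℝ N (β i j))
      (inner ℝ N (β i j)) 0 := fun i j => by
    simpa using ((hasDerivAt_id (0 : ℝ)).mul_const (inner ℝ N (β i j) : ℝ)).const_add
      (inner ℝ N (b i j) : ℝ)
  have hl : ∀ l, HasDerivAt (fun t : ℝ => t * (inner ℝ N (α l) : ℝ)) (inner ℝ N (α l)) 0 :=
    fun l => by simpa using (hasDerivAt_id (0 : ℝ)).mul_const (inner ℝ N (α l) : ℝ)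
  have ha : ∀ i j k, HasDerivAt (fun t : ℝ => (inner ℝ (a k + t • α k) (b i j + t • β i j) : ℝ))
      (inner ℝ (a k) (β i j) + inner ℝ (α k) (b i j)) 0 := fun i j k => by
    have h1 : HasDerivAt (fun t : ℝ => a k + t • α k) (α k) 0 := by
      simpa using ((hasDerivAt_id (0 : ℝ)).smul_const (α k)).const_add (a k)
    have h2 : HasDerivAt (fun t : ℝ => b i j + t • β i j) (β i j) 0 := by
      simpa using ((hasDerivAt_id (0 : ℝ)).smul_const (β i j)).const_add (b i j)
    simpa using h1.inner ℝ h2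
  -- Since N ⟂ a_l, its pairing with a_l + tα_l is t⟨N, α_l⟩; the explicit t leaves only the values
  -- at 0 of the other factors.
  have hn : ∀ i j, HasDerivAt (fun t : ℝ => (inner ℝ N (b i j) : ℝ) + t * inner ℝ N (β i j)
      - ∑ k, ∑ l, (gram (fun k => a k + t • α k))⁻¹ k l
        * inner ℝ (a k + t • α k) (b i j + t • β i j) * (t * inner ℝ N (α l)))
      (inner ℝ N (β i j) - ∑ k, ∑ l, (gram a)⁻¹ k l * inner ℝ (a k) (b i j) * inner ℝ N (α l)) 0 := by
    intro i j
    refine (hb i j).fun_sub (HasDerivAt.fun_sum fun k _ => HasDerivAt.fun_sum fun l _ => ?_)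
    refine (((hq k l).fun_mul (ha i j k)).fun_mul (hl l)).congr_deriv ?_
    simp
  have hs : HasDerivAt (fun t : ℝ => (1 / 2 : ℝ) * ∑ i, ∑ j, (gram (fun k => a k + t • α k))⁻¹ i j *
      ((inner ℝ N (b i j) : ℝ) + t * inner ℝ N (β i j)
      - ∑ k, ∑ l, (gram (fun k => a k + t • α k))⁻¹ k l
        * inner ℝ (a k + t • α k) (b i j + t • β i j) * (t * inner ℝ N (α l)))) _ 0 :=
    (HasDerivAt.fun_sum fun i _ => HasDerivAt.fun_sum fun j _ =>
      (hq i j).fun_mul (hn i j)).const_mul _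
  have he : (fun t : ℝ => (inner ℝ N
        (jetMeanCurv (fun k => a k + t • α k) (fun i j => b i j + t • β i j)) : ℝ)) =
      (fun t : ℝ => (1 / 2 : ℝ) * ∑ i, ∑ j, (gram (fun k => a k + t • α k))⁻¹ i j *
      ((inner ℝ N (b i j) : ℝ) + t * inner ℝ N (β i j)
      - ∑ k, ∑ l, (gram (fun k => a k + t • α k))⁻¹ k l
        * inner ℝ (a k + t • α k) (b i j + t • β i j) * (t * inner ℝ N (α l)))) := by
    ext t
    simp only [jetMeanCurv, normalPart, inner_smul_right, inner_sum, inner_sub_right,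
      inner_add_right, hN, zero_add]
  rw [he]
  refine hs.congr_deriv ?_
  simp only [gram_inv_conformal h00 h11 h01, Fin.sum_univ_two, zero_smul, add_zero]
  simp
  -- The leftover terms involve only the tangential part of b₀₀ + b₁₁, which is zero.
  linear_combination (-(c⁻¹ * c⁻¹ * inner ℝ N (α 0))) * htr 0
    - (c⁻¹ * c⁻¹ * inner ℝ N (α 1)) * htr 1

/-- First variation of the density `|H|² √(det g)` at a conformal jet. -/
lemma hasDerivAt_jetDensity (htr : ∀ l, (inner ℝ (a l) (b 0 0) + inner ℝ (a l) (b 1 1) : ℝ) = 0)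
    (hN : ∀ l, (inner ℝ (jetMeanCurv a b) (a l) : ℝ) = 0) :
    HasDerivAt (fun t : ℝ => jetDensity (fun k => a k + t • α k) (fun i j => b i j + t • β i j))
      (inner ℝ (jetMeanCurv a b) (β 0 0) + inner ℝ (jetMeanCurv a b) (β 1 1)
        - ∑ i, ∑ j, c⁻¹ * (inner ℝ (α i) (a j) + inner ℝ (α j) (a i)) *
          inner ℝ (jetMeanCurv a b) (b i j)
        + ‖jetMeanCurv a b‖ ^ 2 * (inner ℝ (α 0) (a 0) + inner ℝ (α 1) (a 1))) 0 := by
  have hd := det_gram_conformal h00 h11 h01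
  have h1 := hasDerivAt_inner_jetMeanCurv α b β h00 h11 h01 hc hN htr
  have h2 := hasDerivAt_sqrt_det_gram_conformal α h00 h11 h01 hc
  have hline : ∀ u v : E, ContDiffAt ℝ 1 (fun t : ℝ => u + t • v) 0 := fun u v => by fun_prop
  have h3 : DifferentiableAt ℝ
      (fun t : ℝ => jetMeanCurv (fun k => a k + t • α k) (fun i j => b i j + t • β i j)) 0 :=
    (contDiffAt_jetMeanCurv (fun i => hline (a i) (α i)) (fun i j => hline (b i j) (β i j))
      (by simp [hd, hc.ne'])).differentiableAt (by simp)
  -- The derivative of |H|² needs only ⟨H, H'⟩ with the first H frozen at t = 0, so H' itself is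
  -- never computed.
  have h4 : HasDerivAt (fun t : ℝ => (inner ℝ (jetMeanCurv a b)
        (jetMeanCurv (fun k => a k + t • α k) (fun i j => b i j + t • β i j)) : ℝ))
      (inner ℝ (jetMeanCurv a b) (deriv (fun t : ℝ =>
        jetMeanCurv (fun k => a k + t • α k) (fun i j => b i j + t • β i j)) 0)) 0 := by
    simpa using (hasDerivAt_const (0 : ℝ) (jetMeanCurv a b)).inner ℝ h3.hasDerivAt
  have h5 := h3.hasDerivAt.norm_sq.fun_mul h2
  refine h5.congr_deriv ?_
  simp only [zero_smul, add_zero, hd, Real.sqrt_sq hc.le, h4.unique h1, Fin.sum_univ_two]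
  field_simp

end JetVariation

/-! ### Immersed discs and their compactly supported variations -/

section Disc

variable {m : ℕ} {f ξ : Plane → Amb m} {x : Plane}

lemma isOpen_disc : IsOpen disc := Metric.isOpen_ball

lemma IsDiscImmersion.isPatch (hf : IsDiscImmersion f) : IsPatch f disc :=
  ⟨isOpen_disc, hf.smooth, fun x hx => (det_metric_pos_of_injective (hf.injective x hx)).ne'⟩

/-! #### Conformal coordinates -/

lemma IsConformalOnDisc.gram_zero_one (hc : IsConformalOnDisc f) (hx : x ∈ disc) :
    gram (fun k => pd k f x) 0 1 = 0 := (hc x hx).2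

lemma IsConformalOnDisc.gram_one_one (hc : IsConformalOnDisc f) (hx : x ∈ disc) :
    gram (fun k => pd k f x) 1 1 = gram (fun k => pd k f x) 0 0 := by
  rw [gram_apply, gram_apply, real_inner_self_eq_norm_sq, real_inner_self_eq_norm_sq, (hc x hx).1]

lemma IsPatch.gram_zero_zero_pos (hf : IsPatch f disc) (hc : IsConformalOnDisc f) (hx : x ∈ disc) :
    0 < gram (fun k => pd k f x) 0 0 := by
  refine lt_of_le_of_ne (real_inner_self_nonneg (x := pd 0 f x)) fun h => hf.det_ne x hx ?_
  rw [metric_eq_gram, det_gram_conformal rfl (hc.gram_one_one hx) (hc.gram_zero_one hx), ← h]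
  simp

/-- In conformal coordinates the flat Laplacian of `f` is normal. -/
lemma IsPatch.inner_laplacian_conformal (hf : IsPatch f disc) (hc : IsConformalOnDisc f)
    (hx : x ∈ disc) (l : Fin 2) :
    (inner ℝ (pd l f x) (pd 0 (pd 0 f) x) + inner ℝ (pd l f x) (pd 1 (pd 1 f) x) : ℝ) = 0 := by
  have ha := hf.differentiableAt_pd hx
  have h1 : ∀ j, pd j (fun y => (inner ℝ (pd 1 f y) (pd 1 f y) : ℝ)) x =
      pd j (fun y => (inner ℝ (pd 0 f y) (pd 0 f y) : ℝ)) x := fun j =>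
    pd_congr isOpen_disc hx fun y hy => hc.gram_one_one hy
  have h2 : ∀ j, pd j (fun y => (inner ℝ (pd 0 f y) (pd 1 f y) : ℝ)) x = 0 := fun j => by
    rw [pd_congr (v := fun _ => (0 : ℝ)) isOpen_disc hx fun y hy => (hc y hy).2, pd_const]
  simp only [pd_inner (ha _) (ha _)] at h1 h2
  have h10 := h1 0
  have h11 := h1 1
  have h20 := h2 0
  have h21 := h2 1
  simp only [pd_comm isOpen_disc hf.smooth hx 1 0, real_inner_comm (pd 0 f x),
    real_inner_comm (pd 1 f x)] at h10 h11 h20 h21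
  simp only [real_inner_comm _ (pd l f x)]
  fin_cases l
  · simp only [Fin.zero_eta, real_inner_comm (pd 0 f x)]
    linarith
  · simp only [Fin.mk_one, real_inner_comm (pd 1 f x)]
    linarith

/-- Conformal invariance of the Hodge operator on one-forms in dimension two: √(det g) g^{ij} =
δ^{ij}. -/
lemma IsPatch.conservedField_eq (hf : IsPatch f disc) (hc : IsConformalOnDisc f) (hx : x ∈ disc)
    (i : Fin 2) : conservedField f i x = conservedForm f i x := by
  have hpos := hf.gram_zero_zero_pos hc hx
  have hq := gram_inv_conformal (a := fun k => pd k f x) rfl (hc.gram_one_one hx)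
    (hc.gram_zero_one hx)
  have hρ : areaDensity f x = gram (fun k => pd k f x) 0 0 := by
    rw [areaDensity, metric_eq_gram,
      det_gram_conformal rfl (hc.gram_one_one hx) (hc.gram_zero_one hx), Real.sqrt_sq hpos.le]
  have : perpGradGauss f i x = starOne f (fun j => pdMulti j (gaussMap f)) i x := by
    fin_cases i <;>
    simp [perpGradGauss, starOne, metricInv_eq_gram, hq, hρ, smul_smul, hpos.ne']
  rw [conservedField, conservedForm, this]
  rfl

/-! #### The variation of a disc -/

/-- The energy density of `f + t ξ` as a function of `(t, x)`. -/
def variationDensity (f ξ : Plane → Amb m) (p : ℝ × Plane) : ℝ :=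
  jetDensity (fun k => pd k f p.2 + p.1 • pd k ξ p.2)
    (fun i j => pd i (pd j f) p.2 + p.1 • pd i (pd j ξ) p.2)

/-- The derivative in `t` of the energy density of `f + t ξ`. -/
def variationRate (f ξ : Plane → Amb m) (p : ℝ × Plane) : ℝ :=
  fderiv ℝ (variationDensity f ξ) p (1, 0)

/-- The pairs `(t, x)` for which `f + t ξ` is an immersion at `x`. -/
def regularSet (f ξ : Plane → Amb m) : Set (ℝ × Plane) :=
  {p | p.2 ∈ disc ∧ (gram (fun k => pd k f p.2 + p.1 • pd k ξ p.2)).det ≠ 0}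

lemma contDiffOn_line_comp {W : Type*} [NormedAddCommGroup W] [NormedSpace ℝ W] {u v : Plane → W}
    (hu : ContDiffOn ℝ ∞ u disc) (hv : ContDiffOn ℝ ∞ v disc) {p : ℝ × Plane} (hp : p.2 ∈ disc) :
    ContDiffAt ℝ ∞ (fun p : ℝ × Plane => u p.2 + p.1 • v p.2) p := by
  have hu' := (hu.contDiffAt (isOpen_disc.mem_nhds hp)).comp p contDiffAt_snd
  have hv' := (hv.contDiffAt (isOpen_disc.mem_nhds hp)).comp p contDiffAt_snd
  exact hu'.add (contDiffAt_fst.smul hv')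

lemma pd_eq_zero_of_notMem {W : Type*} [NormedAddCommGroup W] [NormedSpace ℝ W] {u : Plane → W}
    (hx : x ∉ tsupport u) (i : Fin 2) : pd i u x = 0 := by
  rw [pd, fderiv_of_notMem_tsupport (𝕜 := ℝ) hx]; rfl

lemma pd_pd_eq_zero_of_notMem (hx : x ∉ tsupport ξ) (i j : Fin 2) : pd i (pd j ξ) x = 0 := by
  have h : ∀ y ∈ (tsupport ξ)ᶜ, pd j ξ y = 0 := fun y hy => pd_eq_zero_of_notMem hy j
  rw [pd_congr (v := fun _ => 0) (isClosed_tsupport ξ).isOpen_compl hx h, pd_const]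

section

variable (hf : IsPatch f disc) (hξ : ContDiff ℝ ∞ ξ)
include hf hξ

lemma isOpen_regularSet : IsOpen (regularSet f ξ) := by
  rw [isOpen_iff_mem_nhds]
  rintro p ⟨hp, hd⟩
  have h1 : ∀ᶠ q : ℝ × Plane in nhds p, q.2 ∈ disc :=
    continuousAt_snd.eventually (isOpen_disc.mem_nhds hp)
  have h2 := (contDiffAt_det_gram fun k => contDiffOn_line_comp (hf.contDiffOn_pd k)
    (pd_contDiffOn isOpen_disc hξ.contDiffOn k) hp).continuousAt.eventually_ne hd
  exact h1.and h2

lemma contDiffAt_variationDensity {p : ℝ × Plane} (hp : p ∈ regularSet f ξ) :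
    ContDiffAt ℝ ∞ (variationDensity f ξ) p :=
  contDiffAt_jetDensity
    (fun k => contDiffOn_line_comp (hf.contDiffOn_pd k)
      (pd_contDiffOn isOpen_disc hξ.contDiffOn k) hp.1)
    (fun i j => contDiffOn_line_comp (hf.contDiffOn_pd_pd i j)
      (pd_contDiffOn isOpen_disc (pd_contDiffOn isOpen_disc hξ.contDiffOn j) i) hp.1) hp.2

lemma continuousOn_variationRate : ContinuousOn (variationRate f ξ) (regularSet f ξ) := by
  have h : ContDiffOn ℝ ∞ (variationDensity f ξ) (regularSet f ξ) := fun p hp =>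
    (contDiffAt_variationDensity hf hξ hp).contDiffWithinAt
  exact (h.continuousOn_fderiv_of_isOpen (isOpen_regularSet hf hξ) (by simp)).clm_apply
    continuousOn_const

lemma hasDerivAt_variationDensity {t : ℝ} (hp : (t, x) ∈ regularSet f ξ) :
    HasDerivAt (fun s => variationDensity f ξ (s, x)) (variationRate f ξ (t, x)) t := by
  have h := ((contDiffAt_variationDensity hf hξ hp).differentiableAt (by simp)).hasFDerivAt
  exact h.comp_hasDerivAt t ((hasDerivAt_id t).prodMk (hasDerivAt_const t x))

lemma pd_variation (hx : x ∈ disc) (t : ℝ) (i : Fin 2) :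
    pd i (fun y => f y + t • ξ y) x = pd i f x + t • pd i ξ x := by
  have h1 := hf.differentiableAt hf.smooth hx
  have h2 := hf.differentiableAt hξ.contDiffOn hx
  rw [pd_add h1 (h2.fun_const_smul t), pd_const_smul t h2]

lemma pd_pd_variation (hx : x ∈ disc) (t : ℝ) (i j : Fin 2) :
    pd i (pd j fun y => f y + t • ξ y) x = pd i (pd j f) x + t • pd i (pd j ξ) x := by
  rw [pd_congr isOpen_disc hx fun y hy => pd_variation hf hξ hy t j]
  have h1 := hf.differentiableAt_pd hx j
  have h2 := hf.differentiableAt (pd_contDiffOn isOpen_disc hξ.contDiffOn j) hx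
  rw [pd_add h1 (h2.fun_const_smul t), pd_const_smul t h2]

lemma isPatch_variation {t : ℝ} (ht : ∀ x ∈ disc, (t, x) ∈ regularSet f ξ) :
    IsPatch (fun y => f y + t • ξ y) disc := by
  refine ⟨isOpen_disc, hf.smooth.add (hξ.contDiffOn.const_smul t), fun x hx => ?_⟩
  have := (ht x hx).2
  rw [metric_eq_gram]
  simpa only [pd_variation hf hξ hx] using this

lemma density_variation {t : ℝ} (ht : ∀ x ∈ disc, (t, x) ∈ regularSet f ξ) (hx : x ∈ disc) :
    ‖meanCurv (fun y => f y + t • ξ y) x‖ ^ 2 * areaDensity (fun y => f y + t • ξ y) x =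
      variationDensity f ξ (t, x) := by
  rw [(isPatch_variation hf hξ ht).meanCurv_eq_jet hx, areaDensity, metric_eq_gram]
  simp only [pd_variation hf hξ hx, pd_pd_variation hf hξ hx]
  rfl

/-- The tube lemma around {0} × supp ξ gives a uniform ε; off the support nothing is perturbed. -/
lemma exists_variation_regular (hs : HasCompactSupport ξ) (hsub : tsupport ξ ⊆ disc) :
    ∃ ε > 0, ∀ t ∈ Metric.closedBall (0 : ℝ) ε, ∀ x ∈ disc, (t, x) ∈ regularSet f ξ := by
  have h0 : ({0} : Set ℝ) ×ˢ tsupport ξ ⊆ regularSet f ξ := by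
    rintro ⟨t, x⟩ ⟨ht, hx⟩
    obtain rfl : t = 0 := ht
    refine ⟨hsub hx, ?_⟩
    simpa [metric_eq_gram] using hf.det_ne x (hsub hx)
  obtain ⟨u, v, hu, -, h0u, hv, huv⟩ :=
    generalized_tube_lemma isCompact_singleton hs (isOpen_regularSet hf hξ) h0
  obtain ⟨ε, hε, hball⟩ := Metric.nhds_basis_closedBall.mem_iff.1 (hu.mem_nhds (h0u rfl))
  refine ⟨ε, hε, fun t ht x hx => ?_⟩
  by_cases hxs : x ∈ tsupport ξ
  · exact huv ⟨hball ht, hv hxs⟩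
  · refine ⟨hx, ?_⟩
    simpa [metric_eq_gram, pd_eq_zero_of_notMem hxs] using hf.det_ne x hx

lemma variationRate_eq_zero {t : ℝ} (ht : (t, x) ∈ regularSet f ξ) (hx : x ∉ tsupport ξ) :
    variationRate f ξ (t, x) = 0 := by
  refine (hasDerivAt_variationDensity hf hξ ht).unique ?_
  simp only [variationDensity, pd_eq_zero_of_notMem hx, pd_pd_eq_zero_of_notMem hx,
    smul_zero]
  exact hasDerivAt_const _ _

/-- Differentiation of the energy under the integral sign. -/
lemma hasDerivAt_energy (hs : HasCompactSupport ξ) (hsub : tsupport ξ ⊆ disc)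
    (hE : HasFiniteEnergy f) :
    HasDerivAt (fun t : ℝ => energy (fun x => f x + t • ξ x))
      (∫ x in disc, variationRate f ξ (0, x)) 0 := by
  obtain ⟨ε, hε, hreg⟩ := exists_variation_regular hf hξ hs hsub
  have hreg' : ∀ t ∈ Metric.ball (0 : ℝ) ε, ∀ x ∈ disc, (t, x) ∈ regularSet f ξ := fun t ht =>
    hreg t (Metric.ball_subset_closedBall ht)
  have hmeas : MeasurableSet disc := isOpen_disc.measurableSet
  have hK : Metric.closedBall (0 : ℝ) ε ×ˢ tsupport ξ ⊆ regularSet f ξ := fun p hp =>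
    hreg p.1 hp.1 p.2 (hsub hp.2)
  obtain ⟨C, hC⟩ := ((isCompact_closedBall (0 : ℝ) ε).prod hs).exists_bound_of_continuousOn
    ((continuousOn_variationRate hf hξ).mono hK)
  have : MeasureTheory.IsFiniteMeasure (MeasureTheory.volume.restrict disc) :=
    MeasureTheory.isFiniteMeasure_restrict.2 MeasureTheory.measure_ball_lt_top.ne
  -- C bounds the rate on the compact [−ε, ε] × supp ξ, and the rate vanishes off the support. The
  -- maximum with 0 covers an empty support, where C may be negative.
  refine (hasDerivAt_integral_of_dominated_loc_of_deriv_le (bound := fun _ => max C 0)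
    (F' := fun t x => variationRate f ξ (t, x))
    (Metric.ball_mem_nhds (0 : ℝ) hε) ?_ ?_ ?_ ?_ (MeasureTheory.integrable_const _) ?_).2
  · filter_upwards [Metric.ball_mem_nhds (0 : ℝ) hε] with t ht
    have hp := isPatch_variation hf hξ (hreg' t ht)
    exact ((hp.contDiffOn_meanCurv.norm_sq ℝ).mul hp.contDiffOn_areaDensity).continuousOn
      |>.aestronglyMeasurable hmeas
  · simpa [HasFiniteEnergy, MeasureTheory.IntegrableOn] using hE
  · refine ContinuousOn.aestronglyMeasurable ?_ hmeas
    exact (continuousOn_variationRate hf hξ).comp (by fun_prop)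
      fun x hx => hreg' 0 (Metric.mem_ball_self hε) x hx
  · filter_upwards [MeasureTheory.ae_restrict_mem hmeas] with x hx t ht
    by_cases hxs : x ∈ tsupport ξ
    · exact (hC (t, x) ⟨Metric.ball_subset_closedBall ht, hxs⟩).trans (le_max_left _ _)
    · rw [variationRate_eq_zero hf hξ (hreg' t ht x hx) hxs, norm_zero]
      exact le_max_right _ _
  · filter_upwards [MeasureTheory.ae_restrict_mem hmeas] with x hx t ht
    refine (hasDerivAt_variationDensity hf hξ (hreg' t ht x hx)).congr_of_eventuallyEq ?_
    filter_upwards [Metric.isOpen_ball.mem_nhds ht] with s hs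
    exact density_variation hf hξ (hreg' s hs) hx

/-- The pointwise first variation in conformal coordinates. -/
lemma variationRate_zero (hc : IsConformalOnDisc f) (hx : x ∈ disc) :
    variationRate f ξ (0, x) =
      ∑ i, (inner ℝ (meanCurv f x) (pd i (pd i ξ) x)
        + inner ℝ (pd i ξ x) (pd i (meanCurv f) x + (1 / 2 : ℝ) • conservedField f i x)) := by
  have h0 : (0, x) ∈ regularSet f ξ := ⟨hx, by simpa [metric_eq_gram] using hf.det_ne x hx⟩
  have hN : ∀ l, (inner ℝ (jetMeanCurv (fun i => pd i f x) (fun i j => pd i (pd j f) x))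
      (pd l f x) : ℝ) = 0 := fun l => by
    rw [← hf.meanCurv_eq_jet hx, inner_meanCurv_pd]
  have hV := hasDerivAt_jetDensity (fun k => pd k ξ x) (fun i j => pd i (pd j f) x)
    (fun i j => pd i (pd j ξ) x) rfl (hc.gram_one_one hx) (hc.gram_zero_one hx)
    (hf.gram_zero_zero_pos hc hx) (hf.inner_laplacian_conformal hc hx) hN
  rw [(hasDerivAt_variationDensity hf hξ h0).unique hV, ← hf.meanCurv_eq_jet hx]
  have hq := gram_inv_conformal (a := fun k => pd k f x) rfl (hc.gram_one_one hx)
    (hc.gram_zero_one hx)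
  simp only [hf.conservedField_eq hc hx, hf.conservedForm_eq hx, hf.normalD_meanCurv hx,
    tangentialForm, metricInv_eq_gram, hq, Fin.sum_univ_two, inner_add_right, inner_sub_right,
    inner_smul_right, pd_comm isOpen_disc hf.smooth hx 1 0]
  simp
  ring

end

end Disc

/-! ### Integrated first variation and the Euler–Lagrange equation -/

section FirstVariation

variable {m : ℕ} {f ξ : Plane → Amb m} {x : Plane}

/-- Nothing is known of f outside the disc; multiplying by a test function makes the expressions
globally smooth. -/
lemma contDiff_of_support_subset {W : Type*} [NormedAddCommGroup W] [NormedSpace ℝ W]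
    {u : Plane → W} {K U : Set Plane} (hU : IsOpen U)
    (hu : ContDiffOn ℝ ∞ u U) (hK : IsClosed K) (hKU : K ⊆ U) (h : ∀ x ∉ K, u x = 0) :
    ContDiff ℝ ∞ u := by
  rw [contDiff_iff_contDiffAt]
  intro x
  by_cases hx : x ∈ U
  · exact hu.contDiffAt (hU.mem_nhds hx)
  · have : u =ᶠ[nhds x] fun _ => 0 :=
      Filter.eventuallyEq_of_mem (hK.isOpen_compl.mem_nhds fun hxK => hx (hKU hxK)) h
    exact contDiffAt_const.congr_of_eventuallyEq this

lemma integral_pd_eq_zero {u : Plane → ℝ} (hu : ContDiff ℝ ∞ u) (hs : HasCompactSupport u)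
    (i : Fin 2) : ∫ x, pd i u x = 0 := by
  have hc : Continuous (fun x => fderiv ℝ u x (coordVec i)) :=
    (hu.continuous_fderiv (by simp)).clm_apply continuous_const
  have hcs : HasCompactSupport (fun x => fderiv ℝ u x (coordVec i)) := hs.fderiv_apply ℝ _
  have h := integral_mul_fderiv_eq_neg_fderiv_mul_of_integrable (μ := MeasureTheory.volume)
    (f := fun _ : Plane => (1 : ℝ)) (g := u) (v := coordVec i) (by simp)
    (by simpa using hc.integrable_of_hasCompactSupport hcs)
    (by simpa using hu.continuous.integrable_of_hasCompactSupport hs)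
    (fun _ _ => differentiableAt_const _) (fun x _ => hu.differentiable (by simp) x)
  simpa [pd] using h

variable (hf : IsPatch f disc) (hc : IsConformalOnDisc f)
include hf hc

lemma contDiffOn_conservedField (i : Fin 2) : ContDiffOn ℝ ∞ (conservedField f i) disc :=
  (hf.contDiffOn_conservedForm i).congr fun _ hy => hf.conservedField_eq hc hy i

lemma contDiffOn_flatDiv : ContDiffOn ℝ ∞ (flatDiv (conservedField f)) disc :=
  (pd_contDiffOn isOpen_disc (contDiffOn_conservedField hf hc 0) 0).add
    (pd_contDiffOn isOpen_disc (contDiffOn_conservedField hf hc 1) 1)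

/-- First variation of the Willmore energy at a conformal disc. -/
lemma hasDerivAt_energy_conformal (hE : HasFiniteEnergy f) (hξ : ContDiff ℝ ∞ ξ)
    (hs : HasCompactSupport ξ) (hsub : tsupport ξ ⊆ disc) :
    HasDerivAt (fun t : ℝ => energy (fun x => f x + t • ξ x))
      (-(1 / 2) * ∫ x in disc, (inner ℝ (ξ x) (flatDiv (conservedField f) x) : ℝ)) 0 := by
  refine (hasDerivAt_energy hf hξ hs hsub hE).congr_deriv ?_
  -- Chosen so that div Y contains every term of the rate with a derivative of ξ, with excess
  -- exactly ½⟨ξ, div X⟩.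
  let Y : Fin 2 → Plane → ℝ := fun i x =>
    inner ℝ (meanCurv f x) (pd i ξ x) + (1 / 2) * inner ℝ (ξ x) (conservedField f i x)
  have hdξ := fun i => pd_contDiffOn isOpen_disc hξ.contDiffOn i
  have hYs : ∀ i, ∀ x ∉ tsupport ξ, Y i x = 0 := fun i x hx => by
    simp [Y, pd_eq_zero_of_notMem hx, image_eq_zero_of_notMem_tsupport hx]
  have hY : ∀ i, ContDiff ℝ ∞ (Y i) := fun i =>
    contDiff_of_support_subset isOpen_disc
      ((hf.contDiffOn_meanCurv.inner ℝ (hdξ i)).add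
        (contDiffOn_const.mul (hξ.contDiffOn.inner ℝ (contDiffOn_conservedField hf hc i))))
      (isClosed_tsupport ξ) hsub (hYs i)
  have hYc : ∀ i, HasCompactSupport (Y i) := fun i => HasCompactSupport.intro hs (hYs i)
  have hYi : ∀ i, MeasureTheory.Integrable (pd i (Y i)) := fun i =>
    (((hY i).continuous_fderiv (by simp)).clm_apply
      continuous_const).integrable_of_hasCompactSupport ((hYc i).fderiv_apply ℝ _)
  have hZs : ∀ x ∉ tsupport ξ, (inner ℝ (ξ x) (flatDiv (conservedField f) x) : ℝ) = 0 :=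
    fun x hx => by simp [image_eq_zero_of_notMem_tsupport hx]
  have hZi : MeasureTheory.Integrable
      fun x => (inner ℝ (ξ x) (flatDiv (conservedField f) x) : ℝ) :=
    (contDiff_of_support_subset isOpen_disc
      (hξ.contDiffOn.inner ℝ (contDiffOn_flatDiv hf hc)) (isClosed_tsupport ξ) hsub
      hZs).continuous.integrable_of_hasCompactSupport (HasCompactSupport.intro hs hZs)
  have hpt : ∀ x ∈ disc, variationRate f ξ (0, x) = pd 0 (Y 0) x + pd 1 (Y 1) x
      - (1 / 2) * inner ℝ (ξ x) (flatDiv (conservedField f) x) := by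
    intro x hx
    have hpd : ∀ i, pd i (Y i) x = inner ℝ (meanCurv f x) (pd i (pd i ξ) x)
        + inner ℝ (pd i ξ x) (pd i (meanCurv f) x + (1 / 2 : ℝ) • conservedField f i x)
        + (1 / 2) * inner ℝ (ξ x) (pd i (conservedField f i) x) := by
      intro i
      have hH := hf.differentiableAt hf.contDiffOn_meanCurv hx
      have h1 := hf.differentiableAt (hdξ i) hx
      have h2 := hf.differentiableAt hξ.contDiffOn hx
      have h3 := hf.differentiableAt (contDiffOn_conservedField hf hc i) hx
      change pd i (fun x => inner ℝ (meanCurv f x) (pd i ξ x)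
        + (1 / 2 : ℝ) • (inner ℝ (ξ x) (conservedField f i x) : ℝ)) x = _
      rw [pd_add (hH.inner ℝ h1) ((h2.inner ℝ h3).fun_const_smul _), pd_const_smul _ (h2.inner ℝ h3),
        pd_inner hH h1, pd_inner h2 h3, inner_add_right, inner_smul_right, smul_eq_mul,
        real_inner_comm (pd i ξ x) (pd i (meanCurv f) x)]
      ring
    rw [variationRate_zero hf hξ hc hx, hpd, hpd, flatDiv, inner_add_right (ξ x),
      Fin.sum_univ_two]
    ring
  have hdiv : ∀ i, ∫ x in disc, pd i (Y i) x = 0 := fun i => by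
    rw [MeasureTheory.setIntegral_eq_integral_of_forall_compl_eq_zero,
      integral_pd_eq_zero (hY i) (hYc i)]
    intro x hx
    have hsupp : tsupport (Y i) ⊆ tsupport ξ :=
      closure_minimal (Function.support_subset_iff'.2 (hYs i)) (isClosed_tsupport ξ)
    exact pd_eq_zero_of_notMem (fun h => hx (hsub (hsupp h))) i
  rw [MeasureTheory.setIntegral_congr_fun isOpen_disc.measurableSet hpt,
    MeasureTheory.integral_sub ((hYi 0).integrableOn.fun_add (hYi 1).integrableOn)
      (hZi.integrableOn.const_mul _),
    MeasureTheory.integral_add (hYi 0).integrableOn (hYi 1).integrableOn, hdiv, hdiv,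
    MeasureTheory.integral_const_mul]
  ring

/-- Variations g·w with w a constant vector reduce the claim to scalar test functions; vanishing
almost everywhere becomes vanishing everywhere by continuity. -/
lemma flatDiv_eq_zero_of_critical (hE : HasFiniteEnergy f)
    (hcrit : ∀ ξ : Plane → Amb m, ContDiff ℝ ∞ ξ → HasCompactSupport ξ → tsupport ξ ⊆ disc →
      HasDerivAt (fun t : ℝ => energy (fun x => f x + t • ξ x)) 0 0) :
    ∀ x ∈ disc, flatDiv (conservedField f) x = 0 := by
  have hcont := (contDiffOn_flatDiv hf hc).continuousOn
  have hloc : MeasureTheory.LocallyIntegrableOn (flatDiv (conservedField f)) disc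
      MeasureTheory.volume :=
    hcont.locallyIntegrableOn isOpen_disc.measurableSet
  have hae := isOpen_disc.ae_eq_zero_of_integral_contDiff_smul_eq_zero hloc fun g hg hgs hgd => by
    refine ext_inner_left ℝ fun w => ?_
    have hsupp : tsupport (fun x => g x • w) ⊆ tsupport g :=
      closure_mono (Function.support_smul_subset_left g fun _ => w)
    have hcs : HasCompactSupport (fun x => g x • w) := hgs.smul_right
    have h1 := hcrit (fun x => g x • w) (hg.smul contDiff_const) hcs (hsupp.trans hgd)
    have h2 := h1.unique (hasDerivAt_energy_conformal hf hc hE (hg.smul contDiff_const) hcs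
      (hsupp.trans hgd))
    have hint : MeasureTheory.Integrable (fun x => g x • flatDiv (conservedField f) x) :=
      (contDiff_of_support_subset isOpen_disc (hg.contDiffOn.smul (contDiffOn_flatDiv hf hc))
        (isClosed_tsupport g) hgd fun x hx => by
          simp [image_eq_zero_of_notMem_tsupport hx]).continuous.integrable_of_hasCompactSupport
        hgs.smul_right
    rw [inner_zero_right, ← integral_inner hint]
    rw [MeasureTheory.setIntegral_eq_integral_of_forall_compl_eq_zero] at h2
    · simp only [inner_smul_left, inner_smul_right] at h2 ⊢
      simpa using h2.symm
    · intro x hx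
      simp [image_eq_zero_of_notMem_tsupport fun h => hx (hgd h)]
  have heq : flatDiv (conservedField f) =ᵐ[MeasureTheory.volume.restrict disc] fun _ => 0 :=
    (MeasureTheory.ae_restrict_iff' isOpen_disc.measurableSet).2 hae
  exact MeasureTheory.Measure.eqOn_open_of_ae_eq heq isOpen_disc hcont continuousOn_const

end FirstVariation

end WillmoreConservation

end

open WillmoreConservation in
/-- First part: the identity, in all local coordinates of the surface. Second part: the
characterization of conformal Willmore discs. -/
theorem mainTheorem8 (m : ℕ) :
    (∀ (M : Type*) [TopologicalSpace M] [ChartedSpace Plane M] [IsManifold (𝓡 2) ∞ M]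
      (Φ : M → Amb m), ContMDiff (𝓡 2) 𝓘(ℝ, Amb m) ∞ Φ →
      (∀ p, Function.Injective (mfderiv (𝓡 2) 𝓘(ℝ, Amb m) Φ p)) →
      ∀ φ ∈ IsManifold.maximalAtlas (𝓡 2) ∞ M, ∀ x ∈ φ.target, ∀ e : Fin 2 → Plane,
        Orthonormal ℝ (fun i => fderiv ℝ (Φ ∘ φ.symm) x (e i)) →
        normalLaplacian (Φ ∘ φ.symm) (meanCurv (Φ ∘ φ.symm)) x
            + tildeA (Φ ∘ φ.symm) x e (meanCurv (Φ ∘ φ.symm) x)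
            - (2 * ‖meanCurv (Φ ∘ φ.symm) x‖ ^ 2) • meanCurv (Φ ∘ φ.symm) x
          = (1 / 2 : ℝ) • codiff (Φ ∘ φ.symm) (conservedForm (Φ ∘ φ.symm)) x) ∧
    (∀ f : Plane → Amb m, IsDiscImmersion f → IsConformalOnDisc f → HasFiniteEnergy f →
      (IsWillmoreDisc f ↔ ∀ x ∈ disc, flatDiv (conservedField f) x = 0)) := by
  refine ⟨fun M _ _ _ Φ hΦ hinj φ hφ x hx e he =>
    (isPatch_of_chart hΦ hinj hφ).willmore_identity hx he, fun f hf hc hE =>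
    ⟨fun hW => flatDiv_eq_zero_of_critical hf.isPatch hc hE hW.critical, fun hdiv =>
      ⟨hf, hE, fun ξ hξ hs hsub => ?_⟩⟩⟩
  refine (hasDerivAt_energy_conformal hf.isPatch hc hE hξ hs hsub).congr_deriv ?_
  rw [MeasureTheory.setIntegral_congr_fun (g := fun _ => (0 : ℝ)) isOpen_disc.measurableSet
    fun x hx => by simp [hdiv x hx]]
  simp
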